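/- Let $n\ge 1$, let $a_j<T_j$ be real numbers ($j=1,\dots,n$), and let $(a,T)=(a_1,T_1)\times\cdots\times(a_n,T_n)$. Let $\mathrm{L}^1(a,T)$ be the space of real-valued Lebesgue integrable functions on $(a,T)$, modulo equality almost everywhere. For $\alpha\in[0,\infty)^n$ and $f\in \mathrm{L}^1(a,T)$, the multidimensional Riemann–Liouville integral $I_a^\alpha f$ is defined, for almost every $x\in(a,T)$, by integrating $f(y)$ over $a_i<y_i<x_i$ against $\frac{(x_i-y_i)^{\alpha_i-1}}{\Gamma(\alpha_i)}\,\mathrm{d}y_i$ in every coordinate $i$ with $\alpha_i>0$, and setting $y_i=x_i$ in every coordinate $i$ with $\alpha_i=0$. For every $\alpha\in[0,\infty)^n$ let $J_a^\alpha:\mathrm{L}^1(a,T)\to \mathrm{L}^1(a,T)$ be a continuous linear operator. Suppose: - Identity: $J_a^{e_i}=I_a^{e_i}$ on $\mathrm{L}^1(a,T)$ for all $i\in\{1,\dots,n\}$, where $e_i$ is the $i$-th canonical vector of $\mathbb{R}^n$; - Index law: $J_a^{\alpha+\beta}=J_a^\alpha\circ J_a^\beta$ on $\mathrm{L}^1(a,T)$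 for all $\alpha,\beta\in[0,\infty)^n$; - Continuity: the map $\alpha\mapsto J_a^\alpha 1$ from $(0,\infty)^n$ to $\mathrm{L}^1(a,T)$ is continuous at one point, where $1$ is the constant function. Then, for every $\alpha\in[0,\infty)^n$ and every $f\in\mathrm{L}^1(a,T)$, the integral defining $I_a^\alpha f(x)$ converges absolutely for almost every $x\in(a,T)$, and $J_a^\alpha=I_a^\alpha$ on $\mathrm{L}^1(a,T)$. (The case $a=(0,\dots,0)$, $T\in(0,\infty)^n$ is included.) -/

import Mathlib

open MeasureTheory Set
open scoped NNReal

/-- Lebesgue measure on the open box `(a, T) = ∏ (a i, T i)`, so that `Lp ℝ 1 (boxMeasure a T)`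
is the real space `L¹(a, T)`. -/
noncomputable def boxMeasure {n : ℕ} (a T : Fin n → ℝ) : Measure (Fin n → ℝ) :=
  volume.restrict (Set.univ.pi fun i => Ioo (a i) (T i))

instance boxMeasure_isFiniteMeasure {n : ℕ} (a T : Fin n → ℝ) :
    IsFiniteMeasure (boxMeasure a T) := by
  refine ⟨?_⟩
  rw [boxMeasure, Measure.restrict_apply_univ, Real.volume_pi_Ioo]
  exact ENNReal.prod_lt_top fun i _ => ENNReal.ofReal_lt_top

/-- The kernel of the one-dimensional Riemann–Liouville integral of order `s ≥ 0` with origin `c`,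
at the point `t`, as a measure in `y`: for `s > 0` it is `(t - y) ^ (s - 1) / Γ(s) dy` on `(c, t)`,
and for `s = 0` (no integration) it is the Dirac mass at `t`. -/
noncomputable def rlKernelOne (c : ℝ) (s : ℝ≥0) (t : ℝ) : Measure ℝ :=
  if s = 0 then Measure.dirac t
  else (volume.restrict (Ioo c t)).withDensity fun y =>
    ENNReal.ofReal ((t - y) ^ ((s : ℝ) - 1) / Real.Gamma (s : ℝ))

/-- The kernel of the multidimensional Riemann–Liouville integral: the product of the
one-dimensional kernels. -/
noncomputable def rlKernel {n : ℕ} (a : Fin n → ℝ) (α : Fin n → ℝ≥0) (x : Fin n → ℝ) :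
    Measure (Fin n → ℝ) :=
  Measure.pi fun i => rlKernelOne (a i) (α i) (x i)

/-- The multidimensional Riemann–Liouville integral `I_a^α f` at `x`: in each coordinate `i` with
`α i > 0` one integrates over `a i < y i < x i` against `(x i - y i) ^ (α i - 1) / Γ(α i)`,
and in each coordinate with `α i = 0` one puts `y i = x i`. -/
noncomputable def riemannLiouville {n : ℕ} (a : Fin n → ℝ) (α : Fin n → ℝ≥0)
    (f : (Fin n → ℝ) → ℝ) (x : Fin n → ℝ) : ℝ :=
  ∫ y, f y ∂(rlKernel a α x)

/-! Let `w γ` be the product of the normalised powers (x_i - a_i)^γ_i / Γ(γ_i + 1), so that `w 0` =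
1 and, by the beta integral, I^α `w γ` = `w (α + γ)`. By Weierstrass the `w k` with integer `k` span
a dense subspace of L¹. The form `B` is symmetric, the I^α are self-adjoint for it, and it is
nondegenerate because `B f (w k)` are polynomial moments of f. Nondegeneracy makes each I^α
injective (`I_injective`), so fractional integrals can be cancelled.

By the index law each J^α commutes with the integrations I^{e_i} = J^{e_i}. An operator in this
commutant is determined by its value at 1, is self-adjoint for `B`, and commutes with every other
operator in it (`Comm.commute`). Commutation with the multiplication M_i by x_i - a_i is a
derivation D_i of this commutative algebra, and D_i I^α = α_i I^{α+e_i}.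

Rational exponents: if A in the commutant satisfies A^q = I^{qγ}, applying D_i and cancelling I^{qγ}
gives D_i A = γ_i A I^{e_i}. For g = A1 this reads M_i g = (γ_i + 1) I^{e_i} g, an Euler-type
equation whose only solutions are the multiples of `w γ` (`eq_smul_w`). Hence A = c I^γ with c^q = 1
(`Comm.eq_smul_I`). The sign ambiguity in c disappears because J^γ is the square of J^{γ/2}.

General exponents (`eq_I`): the index law carries continuity at the single point α₀ to every α,
after composition with an integral that is then cancelled. The analytic half checks that L¹ of the
box has all the properties used. -/

/-- The formal properties of the Riemann–Liouville integrals `I`, of the normalised power functions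
`w`, of the multiplications `M` by the coordinates and of the bilinear form
`(f, g) ↦ (f * 1 * g)(T)` on the space `L¹` of a box with side lengths `ℓ`. -/
structure RLModel (ι E : Type*) [Fintype ι] [DecidableEq ι] [NormedAddCommGroup E]
    [NormedSpace ℝ E] where
  w : (ι → ℝ≥0) → E
  I : (ι → ℝ≥0) → E →L[ℝ] E
  M : ι → E →L[ℝ] E
  B : E →L[ℝ] E →L[ℝ] ℝ
  ℓ : ι → ℝ
  m : (ι → ℝ≥0) → ℝ
  I_w : ∀ α γ, I α (w γ) = w (α + γ)
  M_w : ∀ i γ, M i (w γ) = ((γ i : ℝ) + 1) • w (γ + Pi.single i 1)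
  B_w : ∀ γ δ, B (w γ) (w δ) = m (γ + δ)
  m_pos : ∀ γ, 0 < m γ
  -- On the box, `m γ` is the product of the ℓ_i^(γ_i + 2) / Γ(γ_i + 3), whence the 3.
  m_succ : ∀ i γ, ((γ i : ℝ) + 3) * m (γ + Pi.single i 1) = ℓ i * m γ
  dense_w : (Submodule.span ℝ (range fun k : ι → ℕ => w fun i => (k i : ℝ≥0))).topologicalClosure = ⊤
  -- Moments of high order already determine f; the shift `N` is what yields injectivity of the
  -- integrals.
  B_nondeg : ∀ (N : ι → ℕ) (f : E),
    (∀ k : ι → ℕ, B f (w fun i => ((k i + N i : ℕ) : ℝ≥0)) = 0) → f = 0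
  continuous_w : Continuous w

/-! ### Duality and cancellation in the abstract model -/

namespace RLModel

variable {ι E : Type*} [Fintype ι] [DecidableEq ι] [NormedAddCommGroup E] [NormedSpace ℝ E]
  (S : RLModel ι E)

theorem ext_w {F : Type*} [NormedAddCommGroup F] [NormedSpace ℝ F] {A A' : E →L[ℝ] F}
    (h : ∀ k : ι → ℕ, A (S.w fun i => (k i : ℝ≥0)) = A' (S.w fun i => (k i : ℝ≥0))) : A = A' := by
  refine ContinuousLinearMap.ext_on (s := range fun k : ι → ℕ => S.w fun i => (k i : ℝ≥0)) ?_ ?_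
  · exact Submodule.dense_iff_topologicalClosure_eq_top.2 S.dense_w
  · rintro _ ⟨k, rfl⟩
    exact h k

theorem eq_zero_of_B {f : E} (h : ∀ k : ι → ℕ, S.B f (S.w fun i => (k i : ℝ≥0)) = 0) : f = 0 :=
  S.B_nondeg 0 f fun k => by simpa using h k

theorem eq_of_B {f g : E}
    (h : ∀ k : ι → ℕ, S.B f (S.w fun i => (k i : ℝ≥0)) = S.B g (S.w fun i => (k i : ℝ≥0))) :
    f = g := by
  rw [← sub_eq_zero]
  exact S.eq_zero_of_B fun k => by simp [h k]

theorem I_add (α γ : ι → ℝ≥0) : S.I (α + γ) = S.I α * S.I γ :=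
  S.ext_w fun k => by simp [S.I_w, add_assoc]

theorem I_zero : S.I 0 = 1 := S.ext_w fun k => by simp [S.I_w]

theorem B_symm (f g : E) : S.B f g = S.B g f := by
  have : S.B = S.B.flip := S.ext_w fun j => S.ext_w fun k => by simp [S.B_w, add_comm]
  exact congrArg (fun b : E →L[ℝ] E →L[ℝ] ℝ => b f g) this

theorem B_I (α : ι → ℝ≥0) (f g : E) : S.B (S.I α f) g = S.B f (S.I α g) := by
  have : S.B.comp (S.I α) = (S.B.flip.comp (S.I α)).flip :=
    S.ext_w fun j => S.ext_w fun k => by simp [S.B_w, S.I_w, add_left_comm, add_assoc]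
  exact congrArg (fun b : E →L[ℝ] E →L[ℝ] ℝ => b f g) this

/-- If I^α f = 0, then I^N f = 0 for an integer vector `N` above α. Moving I^N across `B` kills all
moments of f of order at least `N`. -/
theorem I_injective (α : ι → ℝ≥0) : Function.Injective (S.I α) := by
  rw [injective_iff_map_eq_zero]
  intro f hf
  let N : ι → ℕ := fun i => ⌈α i⌉₊
  have hN : (fun i => (N i : ℝ≥0)) = (fun i => (N i : ℝ≥0) - α i) + α := by
    ext1 i
    simp [N, tsub_add_cancel_of_le (Nat.le_ceil (α i))]
  have h0 : S.I (fun i => (N i : ℝ≥0)) f = 0 := by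
    rw [hN, S.I_add]
    simp [hf]
  refine S.B_nondeg N f fun k => ?_
  have : (fun i => ((k i + N i : ℕ) : ℝ≥0)) = (fun i => (N i : ℝ≥0)) + fun i => (k i : ℝ≥0) := by
    ext1 i
    simp [add_comm]
  rw [this, ← S.I_w, ← S.B_I, h0]
  simp

theorem I_mul_cancel (α : ι → ℝ≥0) {A A' : E →L[ℝ] E} (h : S.I α * A = S.I α * A') : A = A' := by
  ext f
  exact S.I_injective α (congrArg (fun b : E →L[ℝ] E => b f) h)

theorem I_natCast_induction (p : (ι → ℝ≥0) → Prop) (h0 : p 0)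
    (hs : ∀ i γ, p γ → p (γ + Pi.single i 1)) (k : ι → ℕ) : p fun i => (k i : ℝ≥0) := by
  have key : ∀ (r : ℕ) (k : ι → ℕ), ∑ i, k i = r → p fun i => (k i : ℝ≥0) := by
    intro r
    induction r with
    | zero =>
      intro k hk
      have : k = 0 := by
        ext1 i
        simpa using (Finset.sum_eq_zero_iff.1 hk) i (Finset.mem_univ i)
      subst this
      simpa [Pi.zero_def] using h0
    | succ r ih =>
      intro k hk
      obtain ⟨i, hi⟩ : ∃ i, k i ≠ 0 := by
        by_contra! hcon
        simp [hcon] at hk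
      have hk' : k = (k - Pi.single i 1) + Pi.single i 1 := by
        ext1 j
        by_cases hj : j = i
        · subst hj
          simp
          omega
        · simp [hj]
      have hsum : ∑ j, (k - Pi.single i 1 : ι → ℕ) j = r := by
        rw [hk'] at hk
        simp only [Pi.add_apply, Finset.sum_add_distrib, Finset.sum_pi_single',
          Finset.mem_univ, if_true] at hk
        omega
      have := hs i _ (ih _ hsum)
      convert this using 1
      ext1 j
      conv_lhs => rw [hk']
      by_cases hj : j = i
      · subst hj
        simp
      · simp [hj]
  exact key _ k rfl

/-! ### The commutant of the integrations and its derivations -/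

/-- `A` commutes with the integrals in each coordinate. -/
def Comm (A : E →L[ℝ] E) : Prop := ∀ i, Commute A (S.I (Pi.single i 1))

variable {S}

theorem Comm.commute_natCast {A : E →L[ℝ] E} (hA : S.Comm A) (k : ι → ℕ) :
    Commute A (S.I fun i => (k i : ℝ≥0)) := by
  refine I_natCast_induction (fun γ => Commute A (S.I γ)) ?_ ?_ k
  · simp [I_zero]
  · intro i γ h
    rw [I_add]
    exact h.mul_right (hA i)

/-- Integer monomials are iterated integrals of 1, so by density the value at 1 determines the
operator. -/
theorem Comm.apply_w {A : E →L[ℝ] E} (hA : S.Comm A) (k : ι → ℕ) :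
    A (S.w fun i => (k i : ℝ≥0)) = S.I (fun i => (k i : ℝ≥0)) (A (S.w 0)) := by
  have := congrArg (fun b : E →L[ℝ] E => b (S.w 0)) (hA.commute_natCast k).eq
  simpa [S.I_w] using this

theorem Comm.ext {A A' : E →L[ℝ] E} (hA : S.Comm A) (hA' : S.Comm A')
    (h : A (S.w 0) = A' (S.w 0)) : A = A' :=
  S.ext_w fun k => by rw [hA.apply_w, hA'.apply_w, h]

theorem comm_I (α : ι → ℝ≥0) : S.Comm (S.I α) := fun i => by
  rw [commute_iff_eq, ← I_add, ← I_add, add_comm]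

/-- On monomials of orders j and k both sides reduce to the pairing of A1 with `w (j + k)`. -/
theorem Comm.B_apply {A : E →L[ℝ] E} (hA : S.Comm A) (f g : E) : S.B (A f) g = S.B f (A g) := by
  have : S.B.comp A = (S.B.flip.comp A).flip :=
    S.ext_w fun j => S.ext_w fun k => by
      simp only [ContinuousLinearMap.comp_apply, ContinuousLinearMap.flip_apply]
      rw [hA.apply_w, hA.apply_w, B_I, ← B_I S (fun i => (k i : ℝ≥0)), S.I_w, S.I_w, add_comm,
        B_symm]
  exact congrArg (fun b : E →L[ℝ] E →L[ℝ] ℝ => b f g) this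

theorem Comm.commute {A A' : E →L[ℝ] E} (hA : S.Comm A) (hA' : S.Comm A') : Commute A A' := by
  refine S.ext_w fun j => S.eq_of_B fun k => ?_
  simp only [mul_apply_eq_comp]
  rw [hA.B_apply (A' _), hA'.B_apply (A _)]
  simp only [hA.apply_w, hA'.apply_w]
  rw [B_I, B_symm, B_I, B_I, B_I]
  simp only [← mul_apply_eq_comp, ← mul_assoc, ← I_add]
  rw [add_comm]

theorem M_mul_I (i : ι) (α : ι → ℝ≥0) :
    S.M i * S.I α = S.I α * S.M i + (α i : ℝ) • S.I (α + Pi.single i 1) :=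
  S.ext_w fun k => by
    simp only [mul_apply_eq_comp, _root_.add_apply,
      _root_.smul_apply, S.I_w, S.M_w, map_smul, Pi.add_apply]
    rw [add_assoc α (fun i => (k i : ℝ≥0)), add_right_comm α (Pi.single i 1),
      add_assoc α (fun i => (k i : ℝ≥0)), ← add_smul]
    congr 1
    push_cast
    ring

/-- The derivation `A ↦ [M i, A]`. -/
def der (S : RLModel ι E) (i : ι) (A : E →L[ℝ] E) : E →L[ℝ] E := S.M i * A - A * S.M i

theorem der_I (i : ι) (α : ι → ℝ≥0) : S.der i (S.I α) = (α i : ℝ) • S.I (α + Pi.single i 1) := by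
  rw [der, M_mul_I]
  abel

/-- Jacobi identity: the commutator of M_i with I^{e_j} is a multiple of I^{e_j+e_i}, which commutes
with A. -/
theorem Comm.der {A : E →L[ℝ] E} (hA : S.Comm A) (i : ι) : S.Comm (S.der i A) := by
  intro j
  have h1 := M_mul_I (S := S) i (Pi.single j 1)
  have hc : Commute A (S.I (Pi.single j 1 + Pi.single i 1)) := by
    rw [I_add]
    exact (hA j).mul_right (hA i)
  set V := S.I (Pi.single j 1)
  set U := S.I (Pi.single j 1 + Pi.single i 1)
  set c : ℝ := ((Pi.single j 1 : ι → ℝ≥0) i : ℝ)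
  have e1 : V * S.M i = S.M i * V - c • U := by rw [h1]; abel
  have hV : A * V = V * A := (hA j).eq
  have hU : A * U = U * A := hc.eq
  rw [commute_iff_eq]
  simp only [RLModel.der, sub_mul, mul_sub]
  rw [mul_assoc (S.M i) A V, hV, ← mul_assoc (S.M i) V A, h1, mul_assoc A, h1, ← mul_assoc V A,
    ← hV, mul_add, add_mul, mul_smul_comm, smul_mul_assoc, hU]
  simp only [mul_assoc]
  abel

/-- The Leibniz rule for a power, valid because A commutes with its derivative; the extra factor A
avoids the exponent q - 1. -/
theorem der_pow {A : E →L[ℝ] E} (hA : S.Comm A) (i : ι) (q : ℕ) :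
    A * S.der i (A ^ q) = (q : ℝ) • (A ^ q * S.der i A) := by
  induction q with
  | zero => simp [der]
  | succ q ih =>
    have h : S.der i (A ^ (q + 1)) = S.der i (A ^ q) * A + A ^ q * S.der i A := by
      simp only [der, pow_succ, sub_mul, mul_sub, mul_assoc]
      abel
    have hc : A * S.der i A = S.der i A * A := (hA.commute (hA.der i)).eq
    rw [h, mul_add, ← mul_assoc, ih, smul_mul_assoc, mul_assoc, ← hc, ← mul_assoc, ← mul_assoc,
      ← pow_succ, ← pow_succ', Nat.cast_succ, add_smul, one_smul]

theorem I_pow (γ : ι → ℝ≥0) (q : ℕ) : S.I γ ^ q = S.I (q • γ) := by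
  induction q with
  | zero => simp [I_zero]
  | succ q ih => rw [pow_succ, ih, ← I_add, succ_nsmul]

theorem w_ne_zero (γ : ι → ℝ≥0) : S.w γ ≠ 0 := by
  intro h
  have := S.B_w γ γ
  rw [h] at this
  simp only [map_zero] at this
  exact (S.m_pos _).ne this

/-- In the box, pairing with `w k` integrates against the powers (T_i - x_i)^(k_i + 1), and x_i -
a_i = ℓ_i - (T_i - x_i). -/
theorem B_M (i : ι) (f : E) (k : ι → ℝ≥0) :
    S.B (S.M i f) (S.w k) =
      S.ℓ i * S.B f (S.w k) - ((k i : ℝ) + 2) * S.B f (S.w (k + Pi.single i 1)) := by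
  have : (S.B.flip (S.w k)).comp (S.M i) =
      S.ℓ i • S.B.flip (S.w k) - ((k i : ℝ) + 2) • S.B.flip (S.w (k + Pi.single i 1)) :=
    S.ext_w fun j => by
      simp only [ContinuousLinearMap.comp_apply, ContinuousLinearMap.flip_apply, S.M_w, map_smul,
        _root_.smul_apply, _root_.sub_apply, S.B_w, smul_eq_mul]
      rw [← S.m_succ i, add_right_comm, ← add_assoc, Pi.add_apply]
      push_cast
      ring
  simpa using congrArg (fun b : E →L[ℝ] ℝ => b f) this

/-- The equation turns into a recursion expressing each moment by a lower one. Once a multiple of `w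
γ` is subtracted to kill the moment against `w 0`, all moments vanish. -/
theorem eq_smul_w {g : E} (γ : ι → ℝ≥0)
    (h : ∀ i, S.M i g = ((γ i : ℝ) + 1) • S.I (Pi.single i 1) g) :
    ∃ c : ℝ, g = c • S.w γ := by
  refine ⟨S.B g (S.w 0) / S.m γ, ?_⟩
  rw [← sub_eq_zero]
  set f := g - (S.B g (S.w 0) / S.m γ) • S.w γ with hf
  have hM : ∀ i, S.M i f = ((γ i : ℝ) + 1) • S.I (Pi.single i 1) f := fun i => by
    rw [hf, map_sub, map_sub, map_smul, map_smul, h, S.M_w, S.I_w, smul_sub, smul_comm, add_comm γ]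
  refine S.eq_zero_of_B fun k => ?_
  refine I_natCast_induction (fun k => S.B f (S.w k) = 0) ?_ ?_ k
  · simp [hf, S.B_w, (S.m_pos γ).ne']
  · intro i k hk
    have h1 := B_M (S := S) i f k
    rw [hM, map_smul, _root_.smul_apply, B_I, S.I_w, hk, add_comm (Pi.single i 1)] at h1
    have h2 : ((γ i : ℝ) + 1 + (k i + 2)) * S.B f (S.w (k + Pi.single i 1)) = 0 := by
      simp only [smul_eq_mul] at h1
      linarith
    exact (mul_eq_zero.1 h2).resolve_left (by positivity)

/-- A `q`-th root of a fractional integral is a real multiple of a fractional integral. -/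
theorem Comm.eq_smul_I {A : E →L[ℝ] E} (hA : S.Comm A) {q : ℕ} (hq : q ≠ 0) (γ : ι → ℝ≥0)
    (h : A ^ q = S.I (q • γ)) : ∃ c : ℝ, c ^ q = 1 ∧ A = c • S.I γ := by
  -- Compute the derivative of A^q by Leibniz and as that of I^{qγ}, then cancel I^{qγ}.
  have hder : ∀ i, S.der i A = (γ i : ℝ) • (A * S.I (Pi.single i 1)) := by
    intro i
    have h1 := der_pow hA i q
    rw [h, der_I, I_add, ← mul_smul_comm, mul_smul_comm, Pi.smul_apply, nsmul_eq_mul] at h1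
    have h2 : S.I (q • γ) * S.der i A = S.I (q • γ) * ((γ i : ℝ) • (A * S.I (Pi.single i 1))) := by
      have hq' : (q : ℝ) ≠ 0 := by exact_mod_cast hq
      have h3 : A * (S.I (q • γ) * S.I (Pi.single i 1)) =
          S.I (q • γ) * (A * S.I (Pi.single i 1)) := by
        rw [← mul_assoc, (hA.commute (comm_I _)).eq, mul_assoc]
      apply smul_right_injective _ hq'
      simp only
      rw [← h1, mul_smul_comm, mul_smul_comm, h3, smul_smul]
      push_cast
      rfl
    exact S.I_mul_cancel _ h2
  -- Evaluate at 1, where M_i 1 = I^{e_i} 1 and A commutes with I^{e_i}.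
  obtain ⟨c, hc⟩ := eq_smul_w (S := S) (g := A (S.w 0)) γ fun i => by
    have h1 := congrArg (fun b : E →L[ℝ] E => b (S.w 0)) (hder i)
    have h2 := congrArg (fun b : E →L[ℝ] E => b (S.w 0)) (hA i).eq
    simp only [RLModel.der, _root_.sub_apply, mul_apply_eq_comp, S.M_w, S.I_w,
      _root_.smul_apply, Pi.zero_apply, NNReal.coe_zero, zero_add, one_smul,
      add_zero] at h1 h2
    rw [h2, sub_eq_iff_eq_add] at h1
    rw [h1, add_smul, one_smul]
  have hcomm : S.Comm (c • S.I γ) := fun i => (comm_I γ i).smul_left c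
  have hAc : A = c • S.I γ := hA.ext hcomm (by simp [hc, S.I_w])
  refine ⟨c, ?_, hAc⟩
  rw [hAc, smul_pow, I_pow] at h
  have h1 := congrArg (fun b : E →L[ℝ] E => b (S.w 0)) h
  simp only [_root_.smul_apply, S.I_w] at h1
  exact smul_left_injective ℝ (w_ne_zero _) (by simpa using h1)

/-- Exponent 0 is reached by cancelling in J^{e_i} J^0 = J^{e_i}, which needs at least one
coordinate. -/
theorem eq_I [Nonempty ι] {J : (ι → ℝ≥0) → E →L[ℝ] E} (h1 : ∀ i, J (Pi.single i 1) = S.I (Pi.single i 1))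
    (hadd : ∀ α γ, J (α + γ) = J α * J γ) (α₀ : ι → ℝ≥0) (hα₀ : ∀ i, 0 < α₀ i)
    (hcont : ContinuousWithinAt (fun α => J α (S.w 0)) {α | ∀ i, 0 < α i} α₀) (α : ι → ℝ≥0) :
    J α = S.I α := by
  have hcomm : ∀ α, S.Comm (J α) := fun α i => by
    rw [← h1, commute_iff_eq, ← hadd, ← hadd, add_comm]
  have hnat : ∀ k : ι → ℕ, J (fun i => (k i : ℝ≥0)) = S.I fun i => (k i : ℝ≥0) := by
    refine I_natCast_induction (fun γ => J γ = S.I γ) ?_ ?_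
    · obtain ⟨i⟩ := ‹Nonempty ι›
      refine S.I_mul_cancel (Pi.single i 1) ?_
      rw [← h1, ← hadd, I_zero, add_zero, mul_one]
    · intro i γ h
      change J (γ + _) = S.I (γ + _)
      rw [hadd, I_add, h, h1]
  have hpow : ∀ (γ : ι → ℝ≥0) (q : ℕ), q ≠ 0 → J γ ^ q = J (q • γ) := by
    intro γ q hq
    induction q, Nat.one_le_iff_ne_zero.2 hq using Nat.le_induction with
    | base => simp
    | succ q hq' ih => rw [pow_succ, ih (by omega), ← hadd, succ_nsmul]
  have hrat : ∀ (k : ι → ℕ) (q : ℕ), q ≠ 0 →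
      J (fun i => (k i : ℝ≥0) / q) = S.I fun i => (k i : ℝ≥0) / q := by
    intro k q hq
    -- Half the target exponent: the root is determined up to a real c with c² = 1, and squaring
    -- removes c.
    set γ : ι → ℝ≥0 := fun i => (k i : ℝ≥0) / (2 * q) with hγ
    have e1 : (fun i => (k i : ℝ≥0) / q) = γ + γ := by
      ext1 i
      simp only [hγ, Pi.add_apply]
      field_simp
      ring
    have e2 : (2 * q) • γ = fun i => (k i : ℝ≥0) := by
      ext1 i
      simp only [hγ, Pi.smul_apply, nsmul_eq_mul]
      push_cast
      field_simp
    obtain ⟨c, hc, hJ⟩ := (hcomm γ).eq_smul_I (q := 2 * q) (by omega) γ (by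
      rw [hpow _ _ (by omega), e2, hnat])
    have hc2 : c * c = 1 := by
      rw [pow_mul, pow_two] at hc
      exact (pow_eq_one_iff_of_nonneg (mul_self_nonneg c) hq).1 hc
    rw [e1, hadd, I_add, hJ, smul_mul_smul_comm, hc2, one_smul]
  have hlim : ∀ (α : ι → ℝ≥0) (N : ι → ℕ), (∀ i, α i ≤ N i) →
      S.I (fun i => α₀ i + N i - α i) (J α (S.w 0)) =
        S.I (fun i => (N i : ℝ≥0)) (J α₀ (S.w 0)) := by
    intro α N hN
    set ρ : ι → ℝ≥0 := fun i => α₀ i + N i - α i with hρ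
    let r : ℕ → ι → ℝ≥0 := fun k i => (⌊ρ i * ((k + 1 : ℕ) : ℝ≥0)⌋₊ : ℝ≥0) / ((k + 1 : ℕ) : ℝ≥0)
    have hr : Filter.Tendsto r Filter.atTop (nhds ρ) := by
      rw [tendsto_pi_nhds]
      intro i
      rw [← NNReal.tendsto_coe]
      have := ((tendsto_nat_floor_mul_div_atTop (R := ℝ) (a := (ρ i : ℝ)) (ρ i).2).comp
        tendsto_natCast_atTop_atTop).comp (Filter.tendsto_add_atTop_nat 1)
      refine this.congr fun k => ?_
      simp only [Function.comp_apply, r]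
      push_cast
      congr 2
    have hJr : ∀ k, J (r k) = S.I (r k) := fun k => hrat _ (k + 1) (Nat.succ_ne_zero k)
    -- Chosen so that N + t = r + α with r rational and t → α₀. The truncated subtraction is exact
    -- once t is positive, which holds eventually since α₀ is positive.
    set t : ℕ → ι → ℝ≥0 := fun k i => r k i + α i - N i with ht
    have htlim : Filter.Tendsto t Filter.atTop (nhds α₀) := by
      have : Filter.Tendsto t Filter.atTop (nhds fun i => ρ i + α i - N i) := by
        rw [tendsto_pi_nhds] at hr ⊢
        intro i
        exact ((hr i).add_const _).sub_const _
      convert this using 2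
      ext1 i
      simp only [hρ]
      rw [tsub_add_cancel_of_le ((hN i).trans le_add_self), add_tsub_cancel_right]
    have htpos : ∀ᶠ k in Filter.atTop, ∀ i, 0 < t k i := by
      rw [Filter.eventually_all]
      intro i
      exact (tendsto_pi_nhds.1 htlim i).eventually (lt_mem_nhds (hα₀ i))
    have hJt : Filter.Tendsto (fun k => J (t k) (S.w 0)) Filter.atTop (nhds (J α₀ (S.w 0))) :=
      hcont.tendsto.comp (tendsto_nhdsWithin_iff.2 ⟨htlim, htpos⟩)
    -- Test weakly: I^{r_k} is moved across `B` onto a monomial, so only continuity of γ ↦ `w γ` is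
    -- needed.
    refine S.eq_of_B fun j => ?_
    have l1 : Filter.Tendsto (fun k => S.B (J α (S.w 0)) (S.w (r k + fun i => (j i : ℝ≥0))))
        Filter.atTop (nhds (S.B (J α (S.w 0)) (S.w (ρ + fun i => (j i : ℝ≥0))))) :=
      ((S.B _).continuous.tendsto _).comp
        ((S.continuous_w.tendsto _).comp (hr.add_const _))
    have l2 : Filter.Tendsto (fun k => S.B (S.I (fun i => (N i : ℝ≥0)) (J (t k) (S.w 0)))
        (S.w fun i => (j i : ℝ≥0))) Filter.atTop
        (nhds (S.B (S.I (fun i => (N i : ℝ≥0)) (J α₀ (S.w 0))) (S.w fun i => (j i : ℝ≥0)))) :=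
      (((S.B.flip (S.w fun i => (j i : ℝ≥0))).comp
        (S.I (fun i => (N i : ℝ≥0)))).continuous.tendsto _).comp hJt
    rw [B_I, S.I_w]
    refine tendsto_nhds_unique l1 (l2.congr' ?_)
    filter_upwards [htpos] with k hk
    have e : (fun i => (N i : ℝ≥0)) + t k = r k + α := by
      ext1 i
      simp only [Pi.add_apply, ht]
      exact add_tsub_cancel_of_le (tsub_pos_iff_lt.1 (hk i)).le
    rw [← S.I_w, ← B_I, ← hnat N, ← hJr, ← mul_apply_eq_comp,
      ← mul_apply_eq_comp, ← hadd, ← hadd, e]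
  refine (hcomm α).ext (comm_I α) ?_
  let N : ι → ℕ := fun i => ⌈α i⌉₊
  have hN : ∀ i, α i ≤ N i := fun i => Nat.le_ceil _
  apply S.I_injective (fun i => α₀ i + N i - α i)
  have hJ0 : J 0 = S.I 0 := by simpa [Pi.zero_def] using hnat 0
  -- The case α = 0 identifies the common right-hand side as I^{α₀+N} 1.
  have h0 := hlim 0 N fun i => by simp
  rw [hlim α N hN, ← h0, hJ0]
  simp only [S.I_w, Pi.zero_apply, tsub_zero, add_zero]
  congr 1
  ext1 i
  simp only [Pi.add_apply]
  rw [tsub_add_cancel_of_le ((hN i).trans le_add_self)]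

end RLModel

/-! ### One-dimensional powers and the beta integral -/

/-- The normalised power function `u ^ b / Γ(b + 1)`. -/
noncomputable def rlPow (b : ℝ≥0) (u : ℝ) : ℝ := u ^ (b : ℝ) / Real.Gamma ((b : ℝ) + 1)

theorem measurable_rlPow (b : ℝ≥0) : Measurable (rlPow b) := by
  unfold rlPow
  fun_prop

theorem rlPow_nonneg (b : ℝ≥0) {u : ℝ} (hu : 0 ≤ u) : 0 ≤ rlPow b u :=
  div_nonneg (Real.rpow_nonneg hu _) (Real.Gamma_pos_of_pos (by positivity)).le

theorem rlPow_add_one_mul (b : ℝ≥0) {u : ℝ} (hu : 0 < u) :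
    u * rlPow b u = ((b : ℝ) + 1) * rlPow (b + 1) u := by
  have h1 : Real.Gamma ((b : ℝ) + 1 + 1) = ((b : ℝ) + 1) * Real.Gamma ((b : ℝ) + 1) :=
    Real.Gamma_add_one (by positivity)
  have h2 : (0 : ℝ) < Real.Gamma ((b : ℝ) + 1) := Real.Gamma_pos_of_pos (by positivity)
  have h3 : (0 : ℝ) < (b : ℝ) + 1 := by positivity
  rw [rlPow, rlPow, NNReal.coe_add, NNReal.coe_one, h1, Real.rpow_add hu, Real.rpow_one]
  field_simp

theorem rlPow_natCast (k : ℕ) (u : ℝ) : rlPow (k : ℝ≥0) u = u ^ k / k.factorial := by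
  rw [rlPow, NNReal.coe_natCast, Real.rpow_natCast, Real.Gamma_nat_eq_factorial]

theorem integral_rpow_mul_sub_rpow {s t c : ℝ} (hs : 0 < s) (ht : 0 < t) (hc : 0 < c) :
    ∫ x in (0 : ℝ)..c, x ^ (s - 1) * (c - x) ^ (t - 1) =
      c ^ (s + t - 1) * (Real.Gamma s * Real.Gamma t / Real.Gamma (s + t)) := by
  have h := Complex.betaIntegral_scaled s t hc
  rw [Complex.betaIntegral_eq_Gamma_mul_div _ _ (by simpa) (by simpa), ← Complex.ofReal_add,
    Complex.Gamma_ofReal, Complex.Gamma_ofReal, Complex.Gamma_ofReal] at h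
  apply Complex.ofReal_injective
  rw [Complex.ofReal_mul, Complex.ofReal_cpow hc.le, ← intervalIntegral.integral_ofReal]
  push_cast at h ⊢
  rw [← h]
  refine intervalIntegral.integral_congr fun x hx => ?_
  rw [uIcc_of_le hc.le] at hx
  rw [Complex.ofReal_cpow hx.1, Complex.ofReal_cpow (sub_nonneg.2 hx.2)]
  push_cast
  rfl

theorem integral_rlKernelOne (c : ℝ) (s b : ℝ≥0) {t : ℝ} (ht : c < t) :
    ∫ y, rlPow b (y - c) ∂(rlKernelOne c s t) = rlPow (s + b) (t - c) := by
  by_cases hs : s = 0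
  · simp [rlKernelOne, hs]
  have hs' : (0 : ℝ) < s := by positivity
  have hmeas : Measurable fun y : ℝ =>
      ENNReal.ofReal ((t - y) ^ ((s : ℝ) - 1) / Real.Gamma (s : ℝ)) := by fun_prop
  rw [rlKernelOne, if_neg hs, integral_withDensity_eq_integral_toReal_smul hmeas (by simp)]
  have e1 : ∫ y in Ioo c t, (ENNReal.ofReal ((t - y) ^ ((s : ℝ) - 1) / Real.Gamma (s : ℝ))).toReal •
      rlPow b (y - c) = ∫ y in Ioo c t, (Real.Gamma s)⁻¹ * (Real.Gamma ((b : ℝ) + 1))⁻¹ *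
        ((y - c) ^ (((b : ℝ) + 1) - 1) * ((t - c) - (y - c)) ^ ((s : ℝ) - 1)) := by
    refine setIntegral_congr_fun measurableSet_Ioo fun y hy => ?_
    rw [ENNReal.toReal_ofReal, rlPow, smul_eq_mul]
    · simp only [add_sub_cancel_right, sub_sub_sub_cancel_right]
      ring
    · exact div_nonneg (Real.rpow_nonneg (sub_pos.2 hy.2).le _) (Real.Gamma_pos_of_pos hs').le
  rw [e1, ← integral_Ioc_eq_integral_Ioo, ← intervalIntegral.integral_of_le ht.le,
    intervalIntegral.integral_const_mul,
    intervalIntegral.integral_comp_sub_right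
      (fun y => y ^ (((b : ℝ) + 1) - 1) * ((t - c) - y) ^ ((s : ℝ) - 1)), sub_self,
    integral_rpow_mul_sub_rpow (by positivity) hs' (sub_pos.2 ht), rlPow]
  have h1 : (0 : ℝ) < Real.Gamma ((b : ℝ) + 1) := Real.Gamma_pos_of_pos (by positivity)
  have h2 : (0 : ℝ) < Real.Gamma (s : ℝ) := Real.Gamma_pos_of_pos hs'
  have e2 : (b : ℝ) + 1 + s - 1 = ((s + b : ℝ≥0) : ℝ) := by push_cast; ring
  have e3 : (b : ℝ) + 1 + s = ((s + b : ℝ≥0) : ℝ) + 1 := by push_cast; ring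
  rw [e2, e3]
  field_simp

/-! ### Kernels as measures and the L¹ bound -/

/-- An upper bound for the total mass of the kernel of order `s` on an interval of length `L`. -/
noncomputable def rlMass (s : ℝ≥0) (L : ℝ) : ENNReal :=
  if s = 0 then 1 else
    ∫⁻ u in Ioo 0 L, ENNReal.ofReal (u ^ ((s : ℝ) - 1) / Real.Gamma (s : ℝ))

theorem rlMass_lt_top (s : ℝ≥0) (L : ℝ) : rlMass s L < ⊤ := by
  unfold rlMass
  split_ifs with hs
  · simp
  have hs' : (0 : ℝ) < s := by positivity
  have : IntegrableOn (fun u : ℝ => u ^ ((s : ℝ) - 1) / Real.Gamma (s : ℝ)) (Ioo 0 L) := by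
    refine Integrable.div_const ?_ _
    rcases le_or_gt L 0 with hL | hL
    · simp [Ioo_eq_empty_of_le hL]
    · have := (intervalIntegral.intervalIntegrable_rpow' (a := 0) (b := L)
        (r := (s : ℝ) - 1) (by linarith)).1
      exact this.mono_set Ioo_subset_Ioc_self
  exact this.lintegral_lt_top

theorem rlKernelOne_univ (c : ℝ) (s : ℝ≥0) (t : ℝ) :
    rlKernelOne c s t univ = rlMass s (t - c) := by
  unfold rlKernelOne rlMass
  split_ifs with hs
  · simp
  rw [withDensity_apply _ MeasurableSet.univ, Measure.restrict_univ,
    ← lintegral_indicator measurableSet_Ioo, ← lintegral_indicator measurableSet_Ioo,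
    ← lintegral_sub_left_eq_self _ t]
  refine lintegral_congr fun y => ?_
  simp only [indicator, mem_Ioo]
  have : (c < t - y ∧ t - y < t) ↔ (0 < y ∧ y < t - c) := by
    constructor <;> rintro ⟨h1, h2⟩ <;> constructor <;> linarith
  simp only [this, sub_sub_cancel]

instance isFiniteMeasure_rlKernelOne (c : ℝ) (s : ℝ≥0) (t : ℝ) :
    IsFiniteMeasure (rlKernelOne c s t) :=
  ⟨by rw [rlKernelOne_univ]; exact rlMass_lt_top _ _⟩

theorem rlKernelOne_apply {c : ℝ} {s : ℝ≥0} (hs : s ≠ 0) (t : ℝ) {A : Set ℝ}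
    (hA : MeasurableSet A) :
    rlKernelOne c s t A = ∫⁻ y in A, ({p : ℝ × ℝ | c < p.2 ∧ p.2 < p.1}.indicator
      (fun p => ENNReal.ofReal ((p.1 - p.2) ^ ((s : ℝ) - 1) / Real.Gamma (s : ℝ)))) (t, y) := by
  rw [rlKernelOne, if_neg hs, withDensity_apply _ hA, Measure.restrict_restrict hA, inter_comm,
    ← Measure.restrict_restrict measurableSet_Ioo, ← lintegral_indicator measurableSet_Ioo]
  rfl

theorem measurable_indicator_rlKernelOne (c : ℝ) (s : ℝ≥0) :
    Measurable ({p : ℝ × ℝ | c < p.2 ∧ p.2 < p.1}.indicator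
      (fun p => ENNReal.ofReal ((p.1 - p.2) ^ ((s : ℝ) - 1) / Real.Gamma (s : ℝ)))) := by
  refine Measurable.indicator (by fun_prop) ?_
  exact (measurableSet_lt measurable_const measurable_snd).inter
    (measurableSet_lt measurable_snd measurable_fst)

theorem measurable_rlKernelOne (c : ℝ) (s : ℝ≥0) : Measurable (rlKernelOne c s) := by
  by_cases hs : s = 0
  · unfold rlKernelOne
    simp only [hs, if_true]
    exact Measure.measurable_dirac
  · refine Measure.measurable_of_measurable_coe _ fun A hA => ?_
    simp only [rlKernelOne_apply hs _ hA]
    exact (measurable_indicator_rlKernelOne c s).lintegral_prod_right'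

/-- Tonelli: averaging the kernel over its upper endpoint gives a bounded density `ρ`, with `ρ` = 1
in the Dirac case. -/
theorem lintegral_rlKernelOne (c T : ℝ) (s : ℝ≥0) : ∃ ρ : ℝ → ENNReal, Measurable ρ ∧
    (∀ y ∈ Ioo c T, ρ y ≤ rlMass s (T - c)) ∧ ∀ A, MeasurableSet A →
      ∫⁻ t in Ioo c T, rlKernelOne c s t A = ∫⁻ y in Ioo c T, A.indicator ρ y := by
  by_cases hs : s = 0
  · refine ⟨1, measurable_one, by simp [rlMass, hs], fun A hA => ?_⟩
    refine lintegral_congr fun y => ?_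
    simp [rlKernelOne, hs, hA, indicator]
  set g := ({p : ℝ × ℝ | c < p.2 ∧ p.2 < p.1}.indicator
      (fun p => ENNReal.ofReal ((p.1 - p.2) ^ ((s : ℝ) - 1) / Real.Gamma (s : ℝ)))) with hg
  have hgm : Measurable g := measurable_indicator_rlKernelOne c s
  refine ⟨fun y => ∫⁻ t in Ioo c T, g (t, y), hgm.lintegral_prod_left', fun y hy => ?_,
    fun A hA => ?_⟩
  · simp only [rlMass, hs, if_false]
    rw [← lintegral_indicator measurableSet_Ioo, ← lintegral_indicator measurableSet_Ioo,
      ← lintegral_add_left_eq_self _ y]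
    refine lintegral_mono fun u => ?_
    simp only [indicator, hg, mem_Ioo, mem_ofPred_eq, add_sub_cancel_left]
    split_ifs with h1 h2 h3 <;> try exact bot_le
    · exact le_rfl
    · exact absurd ⟨by linarith [h2.2], by linarith [h1.2, hy.1]⟩ h3
  · simp only [rlKernelOne_apply hs _ hA]
    rw [lintegral_lintegral_swap (by exact hgm.aemeasurable)]
    rw [← lintegral_indicator hA, ← lintegral_indicator measurableSet_Ioo]
    refine lintegral_congr fun y => ?_
    -- After the swap y runs over all of `A`, but the kernel vanishes unless c < y < t < T.
    by_cases h2 : y ∈ Ioo c T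
    · rw [indicator_of_mem h2]
    rw [indicator_of_notMem h2]
    refine indicator_apply_eq_zero.2 fun _ => ?_
    refine (setLIntegral_congr_fun (g := 0) measurableSet_Ioo fun t ht => ?_).trans lintegral_zero
    simp only [indicator, mem_ofPred_eq]
    exact if_neg fun h => h2 ⟨h.1, h.2.trans ht.2⟩

theorem lintegral_pi_prod_eq_prod {n : ℕ} {μ : Fin n → Measure ℝ} [∀ i, SigmaFinite (μ i)]
    {f : Fin n → ℝ → ENNReal} (hf : ∀ i, Measurable (f i)) :
    ∫⁻ x, ∏ i, f i (x i) ∂(Measure.pi μ) = ∏ i, ∫⁻ x, f i x ∂(μ i) := by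
  induction n with
  | zero => simp
  | succ n ih =>
    calc
      _ = ∫⁻ x : ℝ × (Fin n → ℝ), f 0 x.1 * ∏ i : Fin n, f (Fin.succ i) (x.2 i)
            ∂((μ 0).prod (Measure.pi (fun i ↦ μ i.succ))) := by
          have hm : Measurable fun x : Fin (n + 1) → ℝ => ∏ i, f i (x i) :=
            Finset.measurable_fun_prod _ fun i _ => (hf i).comp (measurable_pi_apply i)
          rw [← ((measurePreserving_piFinSuccAbove μ 0).symm).lintegral_comp hm]
          refine lintegral_congr fun x => ?_
          rw [Fin.prod_univ_succ]
          rfl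
      _ = (∫⁻ x, f 0 x ∂μ 0) * ∏ i : Fin n, ∫⁻ x, f (Fin.succ i) x ∂(μ i.succ) := by
          rw [← ih fun i => hf i.succ,
            ← lintegral_prod_mul (hf 0).aemeasurable (Finset.measurable_fun_prod _ fun i _ =>
              (hf i.succ).comp (measurable_pi_apply i)).aemeasurable]
      _ = ∏ i, ∫⁻ x, f i x ∂(μ i) := by rw [Fin.prod_univ_succ]

theorem boxMeasure_eq_pi {n : ℕ} (a T : Fin n → ℝ) :
    boxMeasure a T = Measure.pi fun i => volume.restrict (Ioo (a i) (T i)) := by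
  rw [boxMeasure, volume_pi, Measure.restrict_pi_pi]

theorem measurableSet_box {n : ℕ} (a T : Fin n → ℝ) :
    MeasurableSet (Set.univ.pi fun i => Ioo (a i) (T i)) :=
  MeasurableSet.univ_pi fun _ => measurableSet_Ioo

theorem ae_mem_box {n : ℕ} (a T : Fin n → ℝ) :
    ∀ᵐ x ∂(boxMeasure a T), ∀ i, x i ∈ Ioo (a i) (T i) := by
  filter_upwards [ae_restrict_mem (measurableSet_box a T)] with x hx i
  exact hx i (mem_univ i)

theorem measurable_rlKernel {n : ℕ} (a : Fin n → ℝ) (α : Fin n → ℝ≥0) :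
    Measurable (rlKernel a α) := by
  unfold rlKernel
  refine Measurable.measure_of_isPiSystem generateFrom_pi.symm isPiSystem_pi ?_ ?_
  · rintro _ ⟨s, hs, rfl⟩
    simp only [Measure.pi_pi]
    exact Finset.measurable_fun_prod _ fun i _ =>
      ((Measure.measurable_coe (show MeasurableSet (s i) from hs i (mem_univ i))).comp (measurable_rlKernelOne _ _)).comp
        (measurable_pi_apply i)
  · simp only [Measure.pi_univ]
    exact Finset.measurable_fun_prod _ fun i _ =>
      ((Measure.measurable_coe MeasurableSet.univ).comp (measurable_rlKernelOne _ _)).comp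
        (measurable_pi_apply i)

/-- This domination gives at once almost everywhere convergence, independence of the representative
and boundedness on L¹, whether or not some orders are 0. It holds because the averaged kernel is a
product of bounded one-dimensional densities. -/
theorem bind_rlKernel_le {n : ℕ} (a T : Fin n → ℝ) (α : Fin n → ℝ≥0) :
    (boxMeasure a T).bind (rlKernel a α) ≤
      (∏ i, rlMass (α i) (T i - a i)) • boxMeasure a T := by
  choose ρ hρm hρle hρ using fun i => lintegral_rlKernelOne (a i) (T i) (α i)
  set μ : Fin n → Measure ℝ := fun i => volume.restrict (Ioo (a i) (T i))
  have hfin : ∀ i, IsFiniteMeasure ((μ i).withDensity (ρ i)) := fun i => by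
    refine isFiniteMeasure_withDensity ?_
    have : ∫⁻ y, ρ i y ∂μ i ≤ ∫⁻ _, rlMass (α i) (T i - a i) ∂μ i :=
      setLIntegral_mono measurable_const (hρle i)
    refine (this.trans_lt ?_).ne
    rw [lintegral_const]
    exact ENNReal.mul_lt_top (rlMass_lt_top _ _) (measure_lt_top _ _)
  have hρpi : Measurable fun y : Fin n → ℝ => ∏ i, ρ i (y i) :=
    Finset.measurable_fun_prod _ fun i _ => (hρm i).comp (measurable_pi_apply i)
  have e1 : Measure.pi (fun i => (μ i).withDensity (ρ i)) =
      (boxMeasure a T).bind (rlKernel a α) := by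
    refine Measure.pi_eq fun s hs => ?_
    rw [Measure.bind_apply (MeasurableSet.univ_pi hs) (measurable_rlKernel a α).aemeasurable]
    simp only [rlKernel, Measure.pi_pi]
    rw [boxMeasure_eq_pi, lintegral_pi_prod_eq_prod
      (f := fun i t => rlKernelOne (a i) (α i) t (s i))
      fun i => (Measure.measurable_coe (hs i)).comp (measurable_rlKernelOne _ _)]
    refine Finset.prod_congr rfl fun i _ => ?_
    rw [hρ i _ (hs i), withDensity_apply _ (hs i), lintegral_indicator (hs i)]
  have e2 : Measure.pi (fun i => (μ i).withDensity (ρ i)) =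
      (boxMeasure a T).withDensity fun y => ∏ i, ρ i (y i) := by
    refine Measure.pi_eq fun s hs => ?_
    rw [withDensity_apply _ (MeasurableSet.univ_pi hs),
      ← lintegral_indicator (MeasurableSet.univ_pi hs)]
    have : ∀ y : Fin n → ℝ, (univ.pi s).indicator (fun y => ∏ i, ρ i (y i)) y =
        ∏ i, (s i).indicator (ρ i) (y i) := fun y => by
      by_cases h : y ∈ univ.pi s
      · rw [indicator_of_mem h]
        exact Finset.prod_congr rfl fun i _ => (indicator_of_mem (h i (mem_univ i)) _).symm
      · rw [indicator_of_notMem h]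
        obtain ⟨i, hi⟩ : ∃ i, y i ∉ s i := by simpa [mem_univ_pi] using h
        exact (Finset.prod_eq_zero (Finset.mem_univ i) (indicator_of_notMem hi _)).symm
    simp only [this]
    rw [boxMeasure_eq_pi, lintegral_pi_prod_eq_prod fun i => (hρm i).indicator (hs i)]
    refine Finset.prod_congr rfl fun i _ => ?_
    rw [withDensity_apply _ (hs i), lintegral_indicator (hs i)]
  rw [← e1, e2, ← withDensity_const]
  refine withDensity_mono ?_
  filter_upwards [ae_mem_box a T] with y hy
  exact Finset.prod_le_prod' fun i _ => hρle i _ (hy i)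

theorem prod_rlMass_ne_top {n : ℕ} (L : Fin n → ℝ) (α : Fin n → ℝ≥0) :
    ∏ i, rlMass (α i) (L i) ≠ ⊤ :=
  (ENNReal.prod_lt_top fun _ _ => rlMass_lt_top _ _).ne

theorem integrable_bind_rlKernel {n : ℕ} {a T : Fin n → ℝ} (α : Fin n → ℝ≥0)
    {f : (Fin n → ℝ) → ℝ} (hf : Integrable f (boxMeasure a T)) :
    Integrable f ((boxMeasure a T).bind (rlKernel a α)) :=
  (hf.smul_measure (prod_rlMass_ne_top _ α)).mono_measure (bind_rlKernel_le a T α)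

theorem ae_integrable_rlKernel {n : ℕ} {a T : Fin n → ℝ} (α : Fin n → ℝ≥0)
    {f : (Fin n → ℝ) → ℝ} (hf : Integrable f (boxMeasure a T)) :
    ∀ᵐ x ∂(boxMeasure a T), Integrable f (rlKernel a α x) := by
  have h := integrable_bind_rlKernel α hf
  exact ((Measure.integrable_comp_iff (κ := ⟨rlKernel a α, measurable_rlKernel a α⟩) h.1).1 h).1

theorem riemannLiouville_congr {n : ℕ} {a T : Fin n → ℝ} (α : Fin n → ℝ≥0)
    {f g : (Fin n → ℝ) → ℝ} (h : f =ᵐ[boxMeasure a T] g) :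
    riemannLiouville a α f =ᵐ[boxMeasure a T] riemannLiouville a α g := by
  have h1 : ∀ᵐ y ∂((boxMeasure a T).bind (rlKernel a α)), f y = g y :=
    ((Measure.absolutelyContinuous_of_le (bind_rlKernel_le a T α)).trans
      (Measure.smul_absolutelyContinuous)).ae_le h
  have h2 := Measure.ae_ae_of_ae_bind (measurable_rlKernel a α).aemeasurable h1
  filter_upwards [h2] with x hx
  exact integral_congr_ae hx

theorem integrable_riemannLiouville {n : ℕ} {a T : Fin n → ℝ} (α : Fin n → ℝ≥0)
    {f : (Fin n → ℝ) → ℝ} (hf : Integrable f (boxMeasure a T)) :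
    Integrable (riemannLiouville a α f) (boxMeasure a T) := by
  have h := integrable_bind_rlKernel α hf
  rw [← ProbabilityTheory.Kernel.coe_mk _ (measurable_rlKernel a α),
    Measure.comp_eq_comp_const_apply] at h
  have h' := h.integral_comp
  rw [ProbabilityTheory.Kernel.const_apply] at h'
  exact h'

theorem integral_norm_riemannLiouville_le {n : ℕ} {a T : Fin n → ℝ} (α : Fin n → ℝ≥0)
    {f : (Fin n → ℝ) → ℝ} (hf : Integrable f (boxMeasure a T)) :
    ∫ x, ‖riemannLiouville a α f x‖ ∂(boxMeasure a T) ≤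
      (∏ i, rlMass (α i) (T i - a i)).toReal * ∫ x, ‖f x‖ ∂(boxMeasure a T) := by
  rw [integral_norm_eq_lintegral_enorm (integrable_riemannLiouville α hf).1,
    integral_norm_eq_lintegral_enorm hf.1, ← ENNReal.toReal_mul]
  refine ENNReal.toReal_mono (ENNReal.mul_ne_top (prod_rlMass_ne_top _ _) hf.2.ne) ?_
  calc ∫⁻ x, ‖riemannLiouville a α f x‖ₑ ∂(boxMeasure a T)
      ≤ ∫⁻ x, ∫⁻ y, ‖f y‖ₑ ∂(rlKernel a α x) ∂(boxMeasure a T) :=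
        lintegral_mono fun x => enorm_integral_le_lintegral_enorm _
    _ = ∫⁻ y, ‖f y‖ₑ ∂((boxMeasure a T).bind (rlKernel a α)) :=
        (Measure.lintegral_bind (measurable_rlKernel a α).aemeasurable
          (integrable_bind_rlKernel α hf).1.enorm).symm
    _ ≤ ∫⁻ y, ‖f y‖ₑ ∂((∏ i, rlMass (α i) (T i - a i)) • boxMeasure a T) :=
        lintegral_mono' (bind_rlKernel_le a T α) le_rfl
    _ = _ := by rw [lintegral_smul_measure, smul_eq_mul]

/-! ### Operators on L¹ -/

/-- A map on integrable functions that is bounded, linear and compatible with equality almost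
everywhere is a continuous linear operator on `L¹`. -/
theorem exists_L1_operator {X : Type*} [MeasurableSpace X] {μ : Measure X}
    (R : (X → ℝ) → X → ℝ) (C : ℝ)
    (hint : ∀ f, Integrable f μ → Integrable (R f) μ)
    (hnorm : ∀ f, Integrable f μ → ∫ x, ‖R f x‖ ∂μ ≤ C * ∫ x, ‖f x‖ ∂μ)
    (hcongr : ∀ f g, f =ᵐ[μ] g → R f =ᵐ[μ] R g)
    (hadd : ∀ f g, Integrable f μ → Integrable g μ → R (f + g) =ᵐ[μ] R f + R g)
    (hsmul : ∀ (c : ℝ) f, R (c • f) =ᵐ[μ] c • R f) :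
    ∃ A : Lp ℝ 1 μ →L[ℝ] Lp ℝ 1 μ, ∀ f : Lp ℝ 1 μ, A f =ᵐ[μ] R f := by
  have hi : ∀ f : Lp ℝ 1 μ, Integrable f μ := L1.integrable_coeFn
  let A₀ : Lp ℝ 1 μ →ₗ[ℝ] Lp ℝ 1 μ :=
    { toFun := fun f => (hint f (hi f)).toL1 (R f)
      map_add' := fun f g => by
        rw [← Integrable.toL1_add, Integrable.toL1_eq_toL1_iff]
        exact (hcongr _ _ (Lp.coeFn_add f g)).trans (hadd _ _ (hi f) (hi g))
      map_smul' := fun c f => by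
        rw [RingHom.id_apply, ← Integrable.toL1_smul, Integrable.toL1_eq_toL1_iff]
        exact (hcongr _ _ (Lp.coeFn_smul c f)).trans (hsmul _ _) }
  have hA₀ : ∀ f : Lp ℝ 1 μ, A₀ f =ᵐ[μ] R f := fun f =>
    Integrable.coeFn_toL1 (hint f (hi f))
  refine ⟨A₀.mkContinuous C fun f => ?_, hA₀⟩
  rw [L1.norm_eq_integral_norm, L1.norm_eq_integral_norm]
  refine le_trans (le_of_eq (integral_congr_ae ?_)) (hnorm f (hi f))
  filter_upwards [hA₀ f] with x hx
  rw [hx]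

theorem exists_rlOperator {n : ℕ} (a T : Fin n → ℝ) (α : Fin n → ℝ≥0) :
    ∃ A : Lp ℝ 1 (boxMeasure a T) →L[ℝ] Lp ℝ 1 (boxMeasure a T),
      ∀ f : Lp ℝ 1 (boxMeasure a T), A f =ᵐ[boxMeasure a T] riemannLiouville a α f := by
  refine exists_L1_operator (riemannLiouville a α) _ (fun f => integrable_riemannLiouville α)
    (fun f => integral_norm_riemannLiouville_le α) (fun f g => riemannLiouville_congr α)
    (fun f g hf hg => ?_) fun c f => ?_
  · filter_upwards [ae_integrable_rlKernel α hf, ae_integrable_rlKernel α hg] with x hx hx'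
    exact integral_add hx hx'
  · exact Filter.Eventually.of_forall fun x => integral_const_mul _ _

/-- The Riemann–Liouville integral as an operator on `L¹`. -/
noncomputable def rlOperator {n : ℕ} (a T : Fin n → ℝ) (α : Fin n → ℝ≥0) :
    Lp ℝ 1 (boxMeasure a T) →L[ℝ] Lp ℝ 1 (boxMeasure a T) :=
  (exists_rlOperator a T α).choose

theorem coeFn_rlOperator {n : ℕ} (a T : Fin n → ℝ) (α : Fin n → ℝ≥0)
    (f : Lp ℝ 1 (boxMeasure a T)) :
    rlOperator a T α f =ᵐ[boxMeasure a T] riemannLiouville a α f :=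
  (exists_rlOperator a T α).choose_spec f

theorem exists_coordOperator {n : ℕ} (a T : Fin n → ℝ) (i : Fin n) :
    ∃ A : Lp ℝ 1 (boxMeasure a T) →L[ℝ] Lp ℝ 1 (boxMeasure a T),
      ∀ f : Lp ℝ 1 (boxMeasure a T), A f =ᵐ[boxMeasure a T] fun x => (x i - a i) * f x := by
  have hle : ∀ᵐ x ∂(boxMeasure a T), ‖x i - a i‖ ≤ T i - a i := by
    filter_upwards [ae_mem_box a T] with x hx
    rw [Real.norm_of_nonneg (sub_nonneg.2 (hx i).1.le)]
    linarith [(hx i).2]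
  have hm : AEStronglyMeasurable (fun x : Fin n → ℝ => x i - a i) (boxMeasure a T) :=
    ((measurable_pi_apply i).sub_const _).aestronglyMeasurable
  have hint : ∀ f, Integrable f (boxMeasure a T) →
      Integrable (fun x : Fin n → ℝ => (x i - a i) * f x) (boxMeasure a T) :=
    fun f hf => hf.bdd_mul hm hle
  refine exists_L1_operator (fun f (x : Fin n → ℝ) => (x i - a i) * f x) (T i - a i) hint ?_ ?_ ?_ ?_
  · intro f hf
    rw [← integral_const_mul]
    refine integral_mono_ae (hint f hf).norm (hf.norm.const_mul _) ?_
    filter_upwards [hle] with x hx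
    rw [norm_mul]
    gcongr
  · intro f g h
    filter_upwards [h] with x hx
    rw [hx]
  · intro f g _ _
    exact Filter.Eventually.of_forall fun x => mul_add _ _ _
  · intro c f
    exact Filter.Eventually.of_forall fun x => mul_left_comm _ _ _

/-- Multiplication by `x i - a i` as an operator on `L¹`. -/
noncomputable def coordOperator {n : ℕ} (a T : Fin n → ℝ) (i : Fin n) :
    Lp ℝ 1 (boxMeasure a T) →L[ℝ] Lp ℝ 1 (boxMeasure a T) :=
  (exists_coordOperator a T i).choose

theorem coeFn_coordOperator {n : ℕ} (a T : Fin n → ℝ) (i : Fin n)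
    (f : Lp ℝ 1 (boxMeasure a T)) :
    coordOperator a T i f =ᵐ[boxMeasure a T] fun x => (x i - a i) * f x :=
  (exists_coordOperator a T i).choose_spec f

/-! ### Power functions on the box -/

theorem rlPow_pos (b : ℝ≥0) {u : ℝ} (hu : 0 < u) : 0 < rlPow b u :=
  div_pos (Real.rpow_pos_of_pos hu _) (Real.Gamma_pos_of_pos (by positivity))

theorem rlPow_mono (b : ℝ≥0) {u v : ℝ} (hu : 0 ≤ u) (h : u ≤ v) : rlPow b u ≤ rlPow b v :=
  div_le_div_of_nonneg_right (Real.rpow_le_rpow hu h b.2)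
    (Real.Gamma_pos_of_pos (by positivity)).le

theorem rlPow_zero (u : ℝ) : rlPow 0 u = 1 := by simp [rlPow]

theorem continuous_rlPow {u : ℝ} (hu : 0 < u) : Continuous fun b => rlPow b u := by
  unfold rlPow
  refine Continuous.div ?_ ?_ fun b => (Real.Gamma_pos_of_pos (by positivity)).ne'
  · exact continuous_const.rpow NNReal.continuous_coe fun _ => Or.inl hu.ne'
  · refine continuous_iff_continuousAt.2 fun b => ?_
    have h : ContinuousAt Real.Gamma ((b : ℝ) + 1) := by
      refine (Real.differentiableAt_Gamma fun m => ?_).continuousAt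
      have : (0 : ℝ) ≤ b := b.2
      have hm : (0 : ℝ) ≤ m := m.cast_nonneg
      exact (by linarith : -(m : ℝ) < (b : ℝ) + 1).ne'
    exact h.comp (f := fun b : ℝ≥0 => (b : ℝ) + 1)
      (NNReal.continuous_coe.add continuous_const).continuousAt

theorem rlPow_natCast_mul (k m : ℕ) (u : ℝ) : rlPow (k : ℝ≥0) u * rlPow (m : ℝ≥0) u =
    ((k + m).factorial / (k.factorial * m.factorial) : ℝ) * rlPow ((k + m : ℕ) : ℝ≥0) u := by
  have h1 : (k.factorial : ℝ) ≠ 0 := by exact_mod_cast k.factorial_ne_zero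
  have h2 : (m.factorial : ℝ) ≠ 0 := by exact_mod_cast m.factorial_ne_zero
  have h3 : ((k + m).factorial : ℝ) ≠ 0 := by exact_mod_cast (k + m).factorial_ne_zero
  rw [rlPow_natCast, rlPow_natCast, rlPow_natCast, pow_add]
  field_simp

theorem integral_rlKernelOne_add_one (c : ℝ) (b : ℝ≥0) (t : ℝ) (f : ℝ → ℝ) :
    ∫ y, f y ∂(rlKernelOne c (b + 1) t) = ∫ y in Ioo c t, rlPow b (t - y) * f y := by
  have hmeas : Measurable fun y : ℝ =>
      ENNReal.ofReal ((t - y) ^ (((b + 1 : ℝ≥0) : ℝ) - 1) / Real.Gamma ((b + 1 : ℝ≥0) : ℝ)) := by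
    fun_prop
  rw [rlKernelOne, if_neg (by positivity),
    integral_withDensity_eq_integral_toReal_smul hmeas (by simp)]
  refine setIntegral_congr_fun measurableSet_Ioo fun y hy => ?_
  have e : (t - y) ^ (((b + 1 : ℝ≥0) : ℝ) - 1) / Real.Gamma ((b + 1 : ℝ≥0) : ℝ) =
      rlPow b (t - y) := by
    rw [rlPow]
    push_cast
    rw [add_sub_cancel_right]
  rw [e, ENNReal.toReal_ofReal (rlPow_nonneg b (sub_pos.2 hy.2).le), smul_eq_mul]

/-- The product of the normalised powers `(x i - a i) ^ γ i / Γ(γ i + 1)`. -/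
noncomputable def boxPow {n : ℕ} (a : Fin n → ℝ) (γ : Fin n → ℝ≥0) (x : Fin n → ℝ) : ℝ :=
  ∏ i, rlPow (γ i) (x i - a i)

theorem measurable_boxPow {n : ℕ} (a : Fin n → ℝ) (γ : Fin n → ℝ≥0) : Measurable (boxPow a γ) :=
  Finset.measurable_fun_prod _ fun i _ =>
    (measurable_rlPow (γ i)).comp ((measurable_pi_apply i).sub_const _)

theorem riemannLiouville_boxPow {n : ℕ} (a : Fin n → ℝ) (α γ : Fin n → ℝ≥0) {x : Fin n → ℝ}
    (hx : ∀ i, a i < x i) : riemannLiouville a α (boxPow a γ) x = boxPow a (α + γ) x := by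
  unfold riemannLiouville rlKernel boxPow
  rw [integral_fintype_prod_eq_prod (f := fun i t => rlPow (γ i) (t - a i))]
  exact Finset.prod_congr rfl fun i _ => integral_rlKernelOne _ _ _ (hx i)

theorem boxPow_add_single {n : ℕ} (a : Fin n → ℝ) (γ : Fin n → ℝ≥0) (i : Fin n) {x : Fin n → ℝ}
    (hx : a i < x i) :
    (x i - a i) * boxPow a γ x = ((γ i : ℝ) + 1) * boxPow a (γ + Pi.single i 1) x := by
  unfold boxPow
  rw [← Finset.mul_prod_erase _ _ (Finset.mem_univ i), ← mul_assoc,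
    rlPow_add_one_mul _ (sub_pos.2 hx), ← Finset.mul_prod_erase _ _ (Finset.mem_univ i), mul_assoc]
  congr 2
  · simp
  · refine Finset.prod_congr rfl fun j hj => ?_
    simp [(Finset.mem_erase.1 hj).1]

theorem norm_boxPow_le {n : ℕ} {a T x : Fin n → ℝ} (γ : Fin n → ℝ≥0)
    (hx : ∀ i, x i ∈ Ioo (a i) (T i)) :
    ‖boxPow a γ x‖ ≤ ∏ i, rlPow (γ i) (T i - a i) := by
  have h : ∀ i, 0 ≤ x i - a i := fun i => sub_nonneg.2 (hx i).1.le
  rw [boxPow, Real.norm_of_nonneg (Finset.prod_nonneg fun i _ => rlPow_nonneg _ (h i))]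
  exact Finset.prod_le_prod (fun i _ => rlPow_nonneg _ (h i)) fun i _ =>
    rlPow_mono _ (h i) (by linarith [(hx i).2])

theorem integrable_boxPow {n : ℕ} (a T : Fin n → ℝ) (γ : Fin n → ℝ≥0) :
    Integrable (boxPow a γ) (boxMeasure a T) := by
  refine Integrable.of_bound (measurable_boxPow a γ).aestronglyMeasurable
    (∏ i, rlPow (γ i) (T i - a i)) ?_
  filter_upwards [ae_mem_box a T] with x hx using norm_boxPow_le γ hx

/-- The normalised power function as an element of `L¹`. -/
noncomputable def boxPowL1 {n : ℕ} (a T : Fin n → ℝ) (γ : Fin n → ℝ≥0) : Lp ℝ 1 (boxMeasure a T) :=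
  (integrable_boxPow a T γ).toL1 (boxPow a γ)

theorem coeFn_boxPowL1 {n : ℕ} (a T : Fin n → ℝ) (γ : Fin n → ℝ≥0) :
    boxPowL1 a T γ =ᵐ[boxMeasure a T] boxPow a γ :=
  Integrable.coeFn_toL1 _

theorem boxPowL1_zero {n : ℕ} (a T : Fin n → ℝ) :
    boxPowL1 a T 0 = Lp.const 1 (boxMeasure a T) (1 : ℝ) := by
  refine Lp.ext ((coeFn_boxPowL1 a T 0).trans ((Lp.coeFn_const _ _ _).trans ?_).symm)
  exact Filter.Eventually.of_forall fun x => by simp [boxPow, rlPow_zero]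

theorem rlOperator_boxPowL1 {n : ℕ} (a T : Fin n → ℝ) (α γ : Fin n → ℝ≥0) :
    rlOperator a T α (boxPowL1 a T γ) = boxPowL1 a T (α + γ) := by
  refine Lp.ext ?_
  filter_upwards [coeFn_rlOperator a T α (boxPowL1 a T γ),
    riemannLiouville_congr α (coeFn_boxPowL1 a T γ), coeFn_boxPowL1 a T (α + γ),
    ae_mem_box a T] with x h1 h2 h3 hx
  rw [h1, h2, h3, riemannLiouville_boxPow a α γ fun i => (hx i).1]

theorem coordOperator_boxPowL1 {n : ℕ} (a T : Fin n → ℝ) (i : Fin n) (γ : Fin n → ℝ≥0) :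
    coordOperator a T i (boxPowL1 a T γ) =
      ((γ i : ℝ) + 1) • boxPowL1 a T (γ + Pi.single i 1) := by
  refine Lp.ext ?_
  filter_upwards [coeFn_coordOperator a T i (boxPowL1 a T γ), coeFn_boxPowL1 a T γ,
    coeFn_boxPowL1 a T (γ + Pi.single i 1),
    Lp.coeFn_smul ((γ i : ℝ) + 1) (boxPowL1 a T (γ + Pi.single i 1)), ae_mem_box a T]
    with x h1 h2 h3 h4 hx
  rw [h1, h2, h4, Pi.smul_apply, h3, smul_eq_mul, boxPow_add_single a γ i (hx i).1]

theorem continuous_boxPowL1 {n : ℕ} {a T : Fin n → ℝ} (haT : ∀ i, a i < T i) :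
    Continuous (boxPowL1 a T) := by
  refine continuous_iff_continuousAt.2 fun γ => ?_
  rw [ContinuousAt, tendsto_iff_norm_sub_tendsto_zero]
  have e : ∀ γ', ‖boxPowL1 a T γ' - boxPowL1 a T γ‖ =
      ∫ x, ‖boxPow a γ' x - boxPow a γ x‖ ∂(boxMeasure a T) := fun γ' => by
    rw [L1.norm_eq_integral_norm]
    refine integral_congr_ae ?_
    filter_upwards [Lp.coeFn_sub (boxPowL1 a T γ') (boxPowL1 a T γ), coeFn_boxPowL1 a T γ',
      coeFn_boxPowL1 a T γ] with x h1 h2 h3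
    rw [h1, Pi.sub_apply, h2, h3]
  simp only [e]
  have hb : Continuous fun γ' : Fin n → ℝ≥0 => ∏ i, rlPow (γ' i) (T i - a i) :=
    continuous_finsetProd _ fun i _ =>
      (continuous_rlPow (sub_pos.2 (haT i))).comp (continuous_apply i)
  set C := ∏ i, rlPow (γ i) (T i - a i) with hC
  have h0 : (0 : ℝ) = ∫ _, (0 : ℝ) ∂(boxMeasure a T) := by simp
  rw [h0]
  refine tendsto_integral_filter_of_dominated_convergence (fun _ => (C + 1) + C) ?_ ?_
    (integrable_const _) ?_
  · exact Filter.Eventually.of_forall fun γ' =>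
      ((measurable_boxPow a γ').sub (measurable_boxPow a γ)).norm.aestronglyMeasurable
  -- Powers are largest at the corner `T`, and the value there depends continuously on the exponent,
  -- so one constant dominates near γ.
  · filter_upwards [hb.continuousAt.eventually (gt_mem_nhds (lt_add_one C))] with γ' hγ'
    filter_upwards [ae_mem_box a T] with x hx
    rw [norm_norm]
    exact (norm_sub_le _ _).trans
      (add_le_add ((norm_boxPow_le γ' hx).trans hγ'.le) (norm_boxPow_le γ hx))
  · filter_upwards [ae_mem_box a T] with x hx
    have hc : Continuous fun γ' : Fin n → ℝ≥0 => boxPow a γ' x :=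
      continuous_finsetProd _ fun i _ =>
        (continuous_rlPow (sub_pos.2 (hx i).1)).comp (continuous_apply i)
    have := ((hc.tendsto γ).sub_const (boxPow a γ x)).norm
    simpa using this

/-! ### Polynomial density and moments -/

/-- The space of polynomial functions, as the span of the normalised monomials. -/
noncomputable def boxPoly {n : ℕ} (a : Fin n → ℝ) : Submodule ℝ ((Fin n → ℝ) → ℝ) :=
  Submodule.span ℝ (range fun k : Fin n → ℕ => boxPow a fun i => (k i : ℝ≥0))

theorem eval_mem_boxPoly {n : ℕ} (a : Fin n → ℝ) (p : MvPolynomial (Fin n) ℝ) :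
    (fun x : Fin n → ℝ => MvPolynomial.eval (fun i => x i - a i) p) ∈ boxPoly a := by
  have e : (fun x : Fin n → ℝ => MvPolynomial.eval (fun i => x i - a i) p) =
      ∑ d ∈ p.support, (p.coeff d * ∏ i, ((d i).factorial : ℝ)) •
        boxPow a fun i => (d i : ℝ≥0) := by
    ext1 x
    rw [MvPolynomial.eval_eq', Finset.sum_apply]
    refine Finset.sum_congr rfl fun d _ => ?_
    rw [Pi.smul_apply, smul_eq_mul, mul_assoc, boxPow, ← Finset.prod_mul_distrib]
    congr 1
    refine Finset.prod_congr rfl fun i _ => ?_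
    rw [rlPow_natCast, mul_div_cancel₀ _ (by exact_mod_cast (d i).factorial_ne_zero)]
  rw [e]
  exact Submodule.sum_mem _ fun d _ =>
    Submodule.smul_mem _ _ (Submodule.subset_span ⟨fun i => d i, rfl⟩)

/-- Stone–Weierstrass on the compact closed box: the shifted coordinates separate points. -/
theorem exists_boxPoly_near {n : ℕ} (a T : Fin n → ℝ) {g : (Fin n → ℝ) → ℝ} (hg : Continuous g)
    {ε : ℝ} (hε : 0 < ε) : ∃ p ∈ boxPoly a, ∀ x ∈ Icc a T, |g x - p x| < ε := by
  let X : Fin n → C(Icc a T, ℝ) := fun i => ⟨fun x => (x : Fin n → ℝ) i - a i,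
    ((continuous_apply i).comp continuous_subtype_val).sub continuous_const⟩
  let A : Subalgebra ℝ C(Icc a T, ℝ) := (MvPolynomial.aeval (R := ℝ) X).range
  have hA : A.SeparatesPoints := by
    intro x y hxy
    obtain ⟨i, hi⟩ : ∃ i, (x : Fin n → ℝ) i ≠ (y : Fin n → ℝ) i := by
      by_contra! h
      exact hxy (Subtype.ext (funext h))
    refine ⟨X i, ⟨X i, ⟨MvPolynomial.X i, by simp⟩, rfl⟩, ?_⟩
    simpa [X, sub_left_inj] using hi
  obtain ⟨⟨q, hq⟩, hqε⟩ := ContinuousMap.exists_mem_subalgebra_near_continuous_of_separatesPoints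
    A hA (fun x : Icc a T => g x) (by fun_prop) ε hε
  obtain ⟨p, rfl⟩ := hq
  refine ⟨_, eval_mem_boxPoly a p, fun x hx => ?_⟩
  have h := hqε ⟨x, hx⟩
  have e : (MvPolynomial.aeval X p : C(Icc a T, ℝ)) ⟨x, hx⟩ =
      MvPolynomial.eval (fun i => x i - a i) p := by
    exact MvPolynomial.comp_aeval_apply (R := ℝ) X
      (ContinuousMap.evalAlgHom ℝ ℝ (⟨x, hx⟩ : Icc a T)) p
  rw [abs_sub_comm]
  simpa [e] using h

theorem boxPoly_ae_mem_span {n : ℕ} {a : Fin n → ℝ} (T : Fin n → ℝ) {p : (Fin n → ℝ) → ℝ}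
    (hp : p ∈ boxPoly a) :
    ∃ P ∈ Submodule.span ℝ (range fun k : Fin n → ℕ => boxPowL1 a T fun i => (k i : ℝ≥0)),
      P =ᵐ[boxMeasure a T] p := by
  induction hp using Submodule.span_induction with
  | mem x hx =>
    obtain ⟨k, rfl⟩ := hx
    exact ⟨_, Submodule.subset_span ⟨k, rfl⟩, coeFn_boxPowL1 _ _ _⟩
  | zero => exact ⟨0, Submodule.zero_mem _, Lp.coeFn_zero _ _ _⟩
  | add p q _ _ hp hq =>
    obtain ⟨P, hP, hPp⟩ := hp
    obtain ⟨Q, hQ, hQq⟩ := hq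
    exact ⟨P + Q, Submodule.add_mem _ hP hQ, (Lp.coeFn_add _ _).trans (hPp.add hQq)⟩
  | smul c p _ hp =>
    obtain ⟨P, hP, hPp⟩ := hp
    exact ⟨c • P, Submodule.smul_mem _ _ hP, (Lp.coeFn_smul _ _).trans (hPp.const_smul c)⟩

theorem topologicalClosure_span_boxPowL1 {n : ℕ} (a T : Fin n → ℝ) :
    (Submodule.span ℝ (range fun k : Fin n → ℕ =>
      boxPowL1 a T fun i => (k i : ℝ≥0))).topologicalClosure = ⊤ := by
  rw [← Submodule.dense_iff_topologicalClosure_eq_top, Metric.dense_iff]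
  intro f ε hε
  have hf : Integrable f (boxMeasure a T) := L1.integrable_coeFn f
  obtain ⟨g, -, hfg, hg, hgi⟩ := hf.exists_hasCompactSupport_integral_sub_le (half_pos hε)
  set V := (boxMeasure a T).real univ with hV
  have hV0 : 0 ≤ V := measureReal_nonneg
  obtain ⟨p, hp, hgp⟩ := exists_boxPoly_near a T hg (ε := ε / 2 / (V + 1)) (by positivity)
  obtain ⟨P, hP, hPp⟩ := boxPoly_ae_mem_span T hp
  refine ⟨P, ?_, hP⟩
  rw [Metric.mem_ball, dist_comm, dist_eq_norm, L1.norm_eq_integral_norm]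
  calc ∫ x, ‖(f - P : Lp ℝ 1 (boxMeasure a T)) x‖ ∂(boxMeasure a T)
      ≤ ∫ x, (‖f x - g x‖ + ε / 2 / (V + 1)) ∂(boxMeasure a T) := by
        refine integral_mono_ae (L1.integrable_coeFn (f - P)).norm
          ((hf.sub hgi).norm.add (integrable_const _)) ?_
        filter_upwards [Lp.coeFn_sub f P, hPp, ae_mem_box a T] with x h1 h2 hx
        rw [h1, Pi.sub_apply, h2]
        have h3 := (hgp x ⟨fun i => (hx i).1.le, fun i => (hx i).2.le⟩).le
        calc ‖f x - p x‖ = ‖(f x - g x) + (g x - p x)‖ := by rw [sub_add_sub_cancel]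
          _ ≤ _ := (norm_add_le _ _).trans (add_le_add le_rfl h3)
    _ = ∫ x, ‖f x - g x‖ ∂(boxMeasure a T) + V * (ε / 2 / (V + 1)) := by
        have h4 : Integrable (fun x => ‖f x - g x‖) (boxMeasure a T) := (hf.sub hgi).norm
        rw [integral_add h4 (integrable_const _), integral_const, smul_eq_mul]
    _ < ε / 2 + ε / 2 := by
        refine add_lt_add_of_le_of_lt hfg ?_
        rw [← mul_div_assoc, div_lt_iff₀ (by positivity)]
        nlinarith
    _ = ε := add_halves ε

theorem ae_eq_zero_of_integral_mul_boxPow {n : ℕ} {a T : Fin n → ℝ} {F : (Fin n → ℝ) → ℝ}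
    (hF : Integrable F (boxMeasure a T))
    (h : ∀ k : Fin n → ℕ,
      ∫ x, F x * boxPow a (fun i => (k i : ℝ≥0)) (a + T - x) ∂(boxMeasure a T) = 0) :
    F =ᵐ[boxMeasure a T] 0 := by
  have hmem : ∀ᵐ x ∂(boxMeasure a T), ∀ i, (a + T - x) i ∈ Ioo (a i) (T i) := by
    filter_upwards [ae_mem_box a T] with x hx i
    have := hx i
    simp only [Pi.sub_apply, Pi.add_apply, mem_Ioo] at this ⊢
    constructor <;> linarith
  have hpoly : ∀ p ∈ boxPoly a,
      Integrable (fun x => F x * p (a + T - x)) (boxMeasure a T) ∧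
        ∫ x, F x * p (a + T - x) ∂(boxMeasure a T) = 0 := by
    intro p hp
    induction hp using Submodule.span_induction with
    | mem x hx =>
      obtain ⟨k, rfl⟩ := hx
      refine ⟨hF.mul_bdd (c := ∏ i, rlPow (k i : ℝ≥0) (T i - a i))
        ((measurable_boxPow a _).comp (measurable_const.sub measurable_id)).aestronglyMeasurable ?_,
        h k⟩
      filter_upwards [hmem] with x hx
      exact norm_boxPow_le _ hx
    | zero => simp
    | add p q _ _ hp hq =>
      simp only [Pi.add_apply, mul_add]
      exact ⟨hp.1.add hq.1, by rw [integral_add hp.1 hq.1, hp.2, hq.2, add_zero]⟩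
    | smul c p _ hp =>
      simp only [Pi.smul_apply, smul_eq_mul, mul_left_comm _ c]
      exact ⟨hp.1.const_mul c, by rw [integral_const_mul, hp.2, mul_zero]⟩
  refine ae_eq_zero_of_integral_contDiff_smul_eq_zero hF.locallyIntegrable fun g hg hgc => ?_
  have hgF : Integrable (fun x => F x * g x) (boxMeasure a T) := by
    obtain ⟨C, hC⟩ := hgc.exists_bound_of_continuous hg.continuous
    exact hF.mul_bdd hg.continuous.aestronglyMeasurable (Filter.Eventually.of_forall hC)
  have hle : ∀ ε > 0, |∫ x, F x * g x ∂(boxMeasure a T)| ≤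
      ε * ∫ x, ‖F x‖ ∂(boxMeasure a T) := by
    intro ε hε
    obtain ⟨p, hp, hgp⟩ := exists_boxPoly_near a T (g := fun x => g (a + T - x))
      (hg.continuous.comp (by fun_prop)) hε
    obtain ⟨hpi, hp0⟩ := hpoly p hp
    have e : ∫ x, F x * g x ∂(boxMeasure a T) =
        ∫ x, (F x * g x - F x * p (a + T - x)) ∂(boxMeasure a T) := by
      rw [integral_sub hgF hpi, hp0, sub_zero]
    rw [e, ← integral_const_mul, ← Real.norm_eq_abs]
    refine norm_integral_le_of_norm_le (hF.norm.const_mul ε) ?_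
    filter_upwards [hmem] with x hx
    have := (hgp (a + T - x) ⟨fun i => (hx i).1.le, fun i => (hx i).2.le⟩).le
    rw [sub_sub_cancel] at this
    rw [← mul_sub, norm_mul, mul_comm]
    gcongr
    exact this
  simp only [smul_eq_mul, mul_comm (g _)]
  by_contra hne
  have hpos := abs_pos.2 hne
  set I := |∫ x, F x * g x ∂(boxMeasure a T)|
  set N := ∫ x, ‖F x‖ ∂(boxMeasure a T)
  have hN0 : 0 ≤ N := integral_nonneg fun _ => norm_nonneg _
  -- With this ε the bound reads I (N + 1) ≤ I N, impossible for I > 0.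
  have h1 := hle (I / (N + 1)) (by positivity)
  rw [div_mul_eq_mul_div, le_div_iff₀ (by positivity)] at h1
  nlinarith

/-- The power of order `N` is absorbed into f as a weight; it is positive inside the box, so it can
be divided out at the end. -/
theorem eq_zero_of_integral_mul_boxPow {n : ℕ} {a T : Fin n → ℝ} (N : Fin n → ℕ)
    (f : Lp ℝ 1 (boxMeasure a T))
    (h : ∀ k : Fin n → ℕ, ∫ x, f x * boxPow a (fun i => ((k i + N i : ℕ) : ℝ≥0)) (a + T - x)
      ∂(boxMeasure a T) = 0) : f = 0 := by
  have hf : Integrable f (boxMeasure a T) := L1.integrable_coeFn f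
  have hmem : ∀ᵐ x ∂(boxMeasure a T), ∀ i, (a + T - x) i ∈ Ioo (a i) (T i) := by
    filter_upwards [ae_mem_box a T] with x hx i
    have := hx i
    simp only [Pi.sub_apply, Pi.add_apply, mem_Ioo] at this ⊢
    constructor <;> linarith
  have hF : Integrable (fun x => f x * boxPow a (fun i => (N i : ℝ≥0)) (a + T - x))
      (boxMeasure a T) := by
    refine hf.mul_bdd (c := ∏ i, rlPow (N i : ℝ≥0) (T i - a i))
      ((measurable_boxPow a _).comp (measurable_const.sub measurable_id)).aestronglyMeasurable ?_
    filter_upwards [hmem] with x hx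
    exact norm_boxPow_le _ hx
  have h0 := ae_eq_zero_of_integral_mul_boxPow hF fun k => by
    have e : ∀ x : Fin n → ℝ, f x * boxPow a (fun i => (N i : ℝ≥0)) (a + T - x) *
        boxPow a (fun i => (k i : ℝ≥0)) (a + T - x) =
        (∏ i, ((k i + N i).factorial / ((k i).factorial * (N i).factorial) : ℝ)) *
          (f x * boxPow a (fun i => ((k i + N i : ℕ) : ℝ≥0)) (a + T - x)) := fun x => by
      simp only [boxPow]
      rw [mul_assoc, mul_left_comm _ (f x), ← Finset.prod_mul_distrib, ← Finset.prod_mul_distrib]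
      congr 1
      refine Finset.prod_congr rfl fun i _ => ?_
      rw [mul_comm (rlPow _ _), rlPow_natCast_mul]
    simp only [e]
    rw [integral_const_mul, h k, mul_zero]
  refine Lp.ext (Filter.EventuallyEq.trans ?_ (Lp.coeFn_zero _ _ _).symm)
  filter_upwards [h0, hmem] with x h1 hx
  refine (mul_eq_zero.1 h1).resolve_right (Finset.prod_pos fun i _ => ?_).ne'
  exact rlPow_pos _ (sub_pos.2 (hx i).1)

/-! ### The bilinear form -/

/-- The integral of `g` over the points `y` of the box with `y < a + T - x`. -/
noncomputable def reflectedIntegral {n : ℕ} (a T : Fin n → ℝ) (g : (Fin n → ℝ) → ℝ)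
    (x : Fin n → ℝ) : ℝ :=
  ∫ y in {y | ∀ i, x i + y i < a i + T i}, g y ∂(boxMeasure a T)

theorem measurableSet_reflected {n : ℕ} (a T : Fin n → ℝ) :
    MeasurableSet {p : (Fin n → ℝ) × (Fin n → ℝ) | ∀ i, p.1 i + p.2 i < a i + T i} := by
  simp only [ofPred_forall]
  exact MeasurableSet.iInter fun i => measurableSet_lt (by fun_prop) measurable_const

theorem norm_reflectedIntegral_le {n : ℕ} {a T : Fin n → ℝ} {g : (Fin n → ℝ) → ℝ}
    (hg : Integrable g (boxMeasure a T)) (x : Fin n → ℝ) :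
    ‖reflectedIntegral a T g x‖ ≤ ∫ y, ‖g y‖ ∂(boxMeasure a T) :=
  (norm_integral_le_integral_norm _).trans
    (setIntegral_le_integral hg.norm (Filter.Eventually.of_forall fun _ => norm_nonneg _))

theorem stronglyMeasurable_reflectedIntegral {n : ℕ} (a T : Fin n → ℝ) {g : (Fin n → ℝ) → ℝ}
    (hg : StronglyMeasurable g) : StronglyMeasurable (reflectedIntegral a T g) := by
  have h : StronglyMeasurable fun p : (Fin n → ℝ) × (Fin n → ℝ) =>
      {p : (Fin n → ℝ) × (Fin n → ℝ) | ∀ i, p.1 i + p.2 i < a i + T i}.indicator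
        (fun p => g p.2) p :=
    (hg.comp_measurable measurable_snd).indicator (measurableSet_reflected a T)
  have h2 := h.integral_prod_right' (ν := boxMeasure a T)
  convert h2 using 2 with x
  rw [reflectedIntegral, ← integral_indicator]
  · rfl
  · exact measurable_prodMk_left (measurableSet_reflected a T)

theorem reflectedIntegral_congr {n : ℕ} {a T : Fin n → ℝ} {g h : (Fin n → ℝ) → ℝ}
    (hgh : g =ᵐ[boxMeasure a T] h) : reflectedIntegral a T g = reflectedIntegral a T h :=
  funext fun _ => integral_congr_ae (ae_restrict_of_ae hgh)

theorem reflectedIntegral_boxPow {n : ℕ} (a T : Fin n → ℝ) (γ : Fin n → ℝ≥0) {x : Fin n → ℝ}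
    (hx : ∀ i, x i ∈ Ioo (a i) (T i)) :
    reflectedIntegral a T (boxPow a γ) x = boxPow a (γ + 1) (a + T - x) := by
  have e1 : {y : Fin n → ℝ | ∀ i, x i + y i < a i + T i} =
      univ.pi fun i => Iio ((a + T - x) i) := by
    ext y
    simp only [mem_ofPred_eq, mem_univ_pi, mem_Iio, Pi.sub_apply, Pi.add_apply, lt_sub_iff_add_lt']
  rw [reflectedIntegral, e1, boxMeasure_eq_pi, Measure.restrict_pi_pi]
  unfold boxPow
  rw [integral_fintype_prod_eq_prod (f := fun i t => rlPow (γ i) (t - a i))]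
  refine Finset.prod_congr rfl fun i _ => ?_
  have h1 : a i < (a + T - x) i := by
    simp only [Pi.sub_apply, Pi.add_apply]
    linarith [(hx i).2]
  have h2 : (a + T - x) i ≤ T i := by
    simp only [Pi.sub_apply, Pi.add_apply]
    linarith [(hx i).1]
  rw [Measure.restrict_restrict measurableSet_Iio]
  have e2 : Iio ((a + T - x) i) ∩ Ioo (a i) (T i) = Ioo (a i) ((a + T - x) i) := by
    ext t
    simp only [mem_inter_iff, mem_Iio, mem_Ioo]
    constructor
    · exact fun h => ⟨h.2.1, h.1⟩
    · exact fun h => ⟨h.2, h.1, h.2.trans_le h2⟩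
  -- The domain is a product of intervals, so each factor is an ordinary integral, that is, the
  -- kernel of order 1 = 0 + 1.
  have h3 := integral_rlKernelOne (a i) (0 + 1) (γ i) h1
  rw [integral_rlKernelOne_add_one] at h3
  simp only [rlPow_zero, one_mul, zero_add] at h3
  rw [e2, h3, Pi.add_apply, Pi.one_apply, add_comm]

theorem integrable_mul_reflectedIntegral {n : ℕ} {a T : Fin n → ℝ}
    (f g : Lp ℝ 1 (boxMeasure a T)) :
    Integrable (fun x => f x * reflectedIntegral a T g x) (boxMeasure a T) :=
  (L1.integrable_coeFn f).mul_bdd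
    (stronglyMeasurable_reflectedIntegral a T (Lp.stronglyMeasurable g)).aestronglyMeasurable
    (Filter.Eventually.of_forall (norm_reflectedIntegral_le (L1.integrable_coeFn g)))

/-- The bilinear form `(f, g) ↦ ∫∫_{x + y < a + T} f(x) g(y)` on `L¹`. -/
noncomputable def boxForm {n : ℕ} (a T : Fin n → ℝ) :
    Lp ℝ 1 (boxMeasure a T) →L[ℝ] Lp ℝ 1 (boxMeasure a T) →L[ℝ] ℝ :=
  LinearMap.mkContinuous₂
    (LinearMap.mk₂ ℝ (fun f g : Lp ℝ 1 (boxMeasure a T) =>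
      ∫ x, f x * reflectedIntegral a T g x ∂(boxMeasure a T))
      (fun f f' g => by
        rw [← integral_add (integrable_mul_reflectedIntegral f g)
          (integrable_mul_reflectedIntegral f' g)]
        refine integral_congr_ae ?_
        filter_upwards [Lp.coeFn_add f f'] with x hx
        rw [hx, Pi.add_apply, add_mul])
      (fun c f g => by
        rw [smul_eq_mul, ← integral_const_mul]
        refine integral_congr_ae ?_
        filter_upwards [Lp.coeFn_smul c f] with x hx
        rw [hx, Pi.smul_apply, smul_eq_mul, mul_assoc])
      (fun f g g' => by
        rw [← integral_add (integrable_mul_reflectedIntegral f g)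
          (integrable_mul_reflectedIntegral f g')]
        refine integral_congr_ae (Filter.Eventually.of_forall fun x => ?_)
        simp only
        rw [reflectedIntegral_congr (Lp.coeFn_add g g'), ← mul_add]
        congr 1
        exact integral_add (L1.integrable_coeFn g).restrict (L1.integrable_coeFn g').restrict)
      (fun c f g => by
        rw [smul_eq_mul, ← integral_const_mul]
        refine integral_congr_ae (Filter.Eventually.of_forall fun x => ?_)
        simp only
        rw [reflectedIntegral_congr (Lp.coeFn_smul c g), mul_left_comm]
        congr 1
        exact integral_const_mul _ _))
    1 fun f g => by
      rw [one_mul, LinearMap.mk₂_apply, mul_comm, L1.norm_eq_integral_norm f,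
        ← integral_const_mul]
      refine norm_integral_le_of_norm_le ((L1.integrable_coeFn f).norm.const_mul _)
        (Filter.Eventually.of_forall fun x => ?_)
      rw [norm_mul, mul_comm, L1.norm_eq_integral_norm g]
      exact mul_le_mul_of_nonneg_right (norm_reflectedIntegral_le (L1.integrable_coeFn g) x)
        (norm_nonneg _)

theorem boxForm_apply {n : ℕ} {a T : Fin n → ℝ} (f g : Lp ℝ 1 (boxMeasure a T)) :
    boxForm a T f g = ∫ x, f x * reflectedIntegral a T g x ∂(boxMeasure a T) := rfl

theorem boxForm_boxPowL1_right {n : ℕ} {a T : Fin n → ℝ} (f : Lp ℝ 1 (boxMeasure a T))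
    (γ : Fin n → ℝ≥0) : boxForm a T f (boxPowL1 a T γ) =
      ∫ x, f x * boxPow a (γ + 1) (a + T - x) ∂(boxMeasure a T) := by
  rw [boxForm_apply, reflectedIntegral_congr (coeFn_boxPowL1 a T γ)]
  refine integral_congr_ae ?_
  filter_upwards [ae_mem_box a T] with x hx
  rw [reflectedIntegral_boxPow a T γ hx]

/-- The inner integral raises δ_i to δ_i + 1, and a power δ_i + 1 of T_i - t is the kernel of order
δ_i + 2; the beta integral finishes. -/
theorem boxForm_boxPowL1 {n : ℕ} {a T : Fin n → ℝ} (haT : ∀ i, a i < T i) (γ δ : Fin n → ℝ≥0) :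
    boxForm a T (boxPowL1 a T γ) (boxPowL1 a T δ) =
      ∏ i, rlPow ((γ + δ) i + 2) (T i - a i) := by
  rw [boxForm_boxPowL1_right]
  have e : ∫ x, boxPowL1 a T γ x * boxPow a (δ + 1) (a + T - x) ∂(boxMeasure a T) =
      ∫ x, ∏ i, (rlPow (δ i + 1) (T i - x i) * rlPow (γ i) (x i - a i)) ∂(boxMeasure a T) := by
    refine integral_congr_ae ?_
    filter_upwards [coeFn_boxPowL1 a T γ] with x hx
    rw [hx, boxPow, boxPow, mul_comm, ← Finset.prod_mul_distrib]
    refine Finset.prod_congr rfl fun i _ => ?_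
    simp only [Pi.add_apply, Pi.sub_apply, Pi.one_apply]
    congr 2
    ring
  rw [e, boxMeasure_eq_pi, integral_fintype_prod_eq_prod
    (f := fun i t => rlPow (δ i + 1) (T i - t) * rlPow (γ i) (t - a i))]
  refine Finset.prod_congr rfl fun i _ => ?_
  rw [← integral_rlKernelOne_add_one, integral_rlKernelOne _ _ _ (haT i), Pi.add_apply]
  congr 1
  rw [add_comm (γ i)]
  ring

/-! ### The concrete model and the conclusion -/

/-- The Riemann–Liouville integrals on the `L¹` space of a box. -/
noncomputable def boxModel {n : ℕ} {a T : Fin n → ℝ} (haT : ∀ i, a i < T i) :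
    RLModel (Fin n) (Lp ℝ 1 (boxMeasure a T)) where
  w := boxPowL1 a T
  I := rlOperator a T
  M := coordOperator a T
  B := boxForm a T
  ℓ i := T i - a i
  m γ := ∏ i, rlPow (γ i + 2) (T i - a i)
  I_w := rlOperator_boxPowL1 a T
  M_w := coordOperator_boxPowL1 a T
  B_w := boxForm_boxPowL1 haT
  m_pos γ := Finset.prod_pos fun i _ => rlPow_pos _ (sub_pos.2 (haT i))
  m_succ i γ := by
    have h := boxPow_add_single a (fun j => γ j + 2) i (haT i)
    have e : (fun j => (γ + Pi.single i 1 : Fin n → ℝ≥0) j + 2) = (fun j => γ j + 2) + Pi.single i (1 : ℝ≥0) := by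
      ext1 j
      simp only [Pi.add_apply]
      exact add_right_comm _ _ _
    have e3 : ((γ i + 2 : ℝ≥0) : ℝ) + 1 = (γ i : ℝ) + 3 := by
      push_cast
      ring
    rw [e3, ← e] at h
    exact h.symm
  dense_w := topologicalClosure_span_boxPowL1 a T
  B_nondeg N f h := by
    -- Pairing with `w k` integrates against the reflected power of order k + 1, so the moments
    -- start at `N + 1`.
    refine eq_zero_of_integral_mul_boxPow (N + 1) f fun k => ?_
    rw [← h k, boxForm_boxPowL1_right]
    have e : (fun i => ((k i + (N + 1) i : ℕ) : ℝ≥0)) =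
        (fun i => ((k i + N i : ℕ) : ℝ≥0)) + 1 := by
      ext1 i
      simp [add_assoc]
    rw [e]
  continuous_w := continuous_boxPowL1 haT

theorem mainTheorem2 (n : ℕ) (hn : 1 ≤ n) (a T : Fin n → ℝ) (haT : ∀ i, a i < T i)
    (J : (Fin n → ℝ≥0) → (Lp ℝ 1 (boxMeasure a T) →L[ℝ] Lp ℝ 1 (boxMeasure a T)))
    -- Identity: `J^{e_i} = I_a^{e_i}`
    (h_identity : ∀ (i : Fin n) (f : Lp ℝ 1 (boxMeasure a T)),
      ∀ᵐ x ∂(boxMeasure a T), J (Pi.single i 1) f x = riemannLiouville a (Pi.single i 1) f x)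
    -- Index law
    (h_index : ∀ (α β : Fin n → ℝ≥0) (f : Lp ℝ 1 (boxMeasure a T)),
      J (α + β) f = J α (J β f))
    -- Continuity of `α ↦ J^α 1`, from `(0,∞)ⁿ` to `L¹(a, T)`, at one point
    (h_cont : ∃ α₀ : Fin n → ℝ≥0, (∀ i, 0 < α₀ i) ∧
      ContinuousWithinAt (fun α => J α (Lp.const 1 (boxMeasure a T) (1 : ℝ)))
        {α | ∀ i, 0 < α i} α₀) :
    -- `J^α = I_a^α`, the integral defining `I_a^α f` being convergent almost everywhere
    ∀ (α : Fin n → ℝ≥0) (f : Lp ℝ 1 (boxMeasure a T)),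
      ∀ᵐ x ∂(boxMeasure a T),
        Integrable f (rlKernel a α x) ∧ J α f x = riemannLiouville a α f x := by
  intro α f
  obtain ⟨α₀, hα₀, hcont⟩ := h_cont
  have : Nonempty (Fin n) := ⟨⟨0, hn⟩⟩
  have hJ : J α = rlOperator a T α := by
    refine RLModel.eq_I (S := boxModel haT) (J := J) (fun i => ?_) (fun α β => ?_) α₀ hα₀ ?_ α
    · ext1 f
      exact Lp.ext (Filter.EventuallyEq.trans (h_identity i f) (coeFn_rlOperator a T _ f).symm)
    · ext1 f
      exact h_index α β f
    · rw [← boxPowL1_zero] at hcont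
      exact hcont
  filter_upwards [ae_integrable_rlKernel α (L1.integrable_coeFn f), coeFn_rlOperator a T α f]
    with x h1 h2
  exact ⟨h1, by rw [hJ, h2]⟩
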